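/- Let $M$ be a connected smooth manifold with smooth (possibly empty) boundary $\partial M$, equipped with a smooth measure $\mu$ (in local coordinates, a smooth positive density times Lebesgue measure). Let $(E,h^E),(F,h^F)\to M$ be smooth Hermitian vector bundles and let $D\colon C^\infty(M;E)\to C^\infty(M;F)$ be a first-order linear differential operator. Let $\sigma_D(x,\xi)\colon E_x\to F_x$ be its principal symbol, i.e. $\sigma_D(x,\xi)u(x)=\big(D(fu)-fDu\big)(x)$ whenever $f\in C^\infty(M,\mathbb R)$ satisfies $df(x)=\xi$ and $u\in C^\infty(M;E)$. Let $D^\dagger\colon C^\infty(M;F)\to C^\infty(M;E)$ be the formal adjoint of $D$, i.e. the unique linear operator with $\langle Du,v\rangle_{L^2(M;F)}=\langle u,D^\dagger v\rangle_{L^2(M;E)}$ for all $v\in C^\infty(M;F)$ and all $u\in C^\infty_{cc}(M;E)$, where $C^\infty_{cc}$ denotes the smooth sections whose support is compact and contained in the interior of $M$. Let $D_{\max}=(D^\dagger)^{*}$ be the Hilbert space adjoint of $D^\dagger$ restricted to $C^\infty_{cc}(M;F)$, as an unbounded operator from $L^2(M;F)$ to $L^2(M;E)$, and let $(D^\dagger)_{\max}=D^{*}$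 be the Hilbert space adjoint of $D$ restricted to $C^\infty_{cc}(M;E)$. Suppose that $M$ carries a complete Riemannian metric (not necessarily related to $\mu$) with distance function $\mathrm{dist}$, a point $p\in M$ and a positive, monotonically increasing (not necessarily strictly), continuous function $C\colon[0,\infty)\to\mathbb R$ with $$\int_0^\infty\frac{dr}{C(r)}=\infty$$ such that the operator norm of the principal symbol satisfies $$|\sigma_D(x,\xi)|\le C(\mathrm{dist}(x,p))\,|\xi|\qquad\text{for all }x\in M,\ \xi\in T_x^*M .$$ Then $D$ and $D^\dagger$ are complete: the elements of $\mathrm{dom}(D_{\max})$ with compact support in $M$ (the support may meet $\partial M$) are dense in $\mathrm{dom}(D_{\max})$ for the graph norm $(\|u\|_{L^2}^2+\|D_{\max}u\|_{L^2}^2)^{1/2}$, and likewise the compactly supported elements of $\mathrm{dom}((D^\dagger)_{\max})$ are dense in $\mathrm{dom}((D^\dagger)_{\max})$ for its graph norm. -/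

import Mathlib

open Bundle Manifold MeasureTheory Set
open scoped ContDiff ENNReal Topology

noncomputable section

namespace FirstOrderCompleteness

/-! ### Smooth measures -/

section Measures

variable {n : ℕ} {H : Type*} [TopologicalSpace H]
  (I : ModelWithCorners ℝ (EuclideanSpace ℝ (Fin n)) H)
  {M : Type*} [TopologicalSpace M] [ChartedSpace H M] [MeasurableSpace M]

/-- A measure is smooth if in local coordinates around every point it has a smooth, everywhere
positive density with respect to Lebesgue measure. -/
def IsSmoothMeasure (μ : Measure M) : Prop :=
  ∀ x₀ : M, ∃ ρ : EuclideanSpace ℝ (Fin n) → ℝ,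
    ContDiffOn ℝ ∞ ρ (extChartAt I x₀).target ∧
    (∀ y ∈ (extChartAt I x₀).target, 0 < ρ y) ∧
    ∀ s ⊆ (extChartAt I x₀).source, MeasurableSet s →
      μ s = ∫⁻ y in extChartAt I x₀ '' s, ENNReal.ofReal (ρ y)

end Measures

/-! ### Smooth sections of complex vector bundles -/

section Sections

variable {n : ℕ} {H : Type*} [TopologicalSpace H]
  (I : ModelWithCorners ℝ (EuclideanSpace ℝ (Fin n)) H)
  {M : Type*} [TopologicalSpace M] [ChartedSpace H M]
  (E₀ : Type*) [NormedAddCommGroup E₀] [NormedSpace ℂ E₀]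
  (E : M → Type*) [TopologicalSpace (TotalSpace E₀ E)]
  [∀ x, NormedAddCommGroup (E x)] [∀ x, InnerProductSpace ℂ (E x)]
  [FiberBundle E₀ E] [VectorBundle ℂ E₀ E] [VectorBundle ℝ E₀ E]

/-- The complex vector space `C^∞(M; E)` of smooth sections of `E` (smooth up to the boundary). -/
def SmoothSections : Submodule ℂ (∀ x, E x) where
  carrier := {u | ContMDiff I (I.prod 𝓘(ℝ, E₀)) ∞ (fun x => TotalSpace.mk' E₀ x (u x))}
  add_mem' hu hv := ContMDiff.add_section hu hv
  zero_mem' := contMDiff_zeroSection ℝ E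
  smul_mem' c u hu := by
    intro x₀
    have h := hu x₀
    rw [contMDiffAt_section] at h ⊢
    refine ((ContinuousLinearMap.contMDiff (c • ContinuousLinearMap.id ℝ E₀)).contMDiffAt.comp
      x₀ h).congr_of_eventuallyEq ?_
    filter_upwards [(trivializationAt E₀ E x₀).open_baseSet.mem_nhds
      (mem_baseSet_trivializationAt E₀ E x₀)] with x hx
    exact ((trivializationAt E₀ E x₀).linear ℂ hx).2 c (u x)


variable {I E₀ E}

/-- The product `f u` of a smooth real function and a smooth section. -/
def mulFun (f : C^∞⟮I, M; ℝ⟯) (u : SmoothSections I E₀ E) :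
    SmoothSections I E₀ E :=
  ⟨fun x => f x • u.1 x, ContMDiff.smul_section f.contMDiff u.2⟩

/-- The section written in the preferred trivialization around `x₀`, as a function with values in
the model fibre. It is meaningful on the base set of that trivialization. -/
def localRep (E₀ : Type*) [NormedAddCommGroup E₀] [NormedSpace ℂ E₀]
    {E : M → Type*} [TopologicalSpace (TotalSpace E₀ E)]
    [∀ x, NormedAddCommGroup (E x)] [FiberBundle E₀ E]
    (x₀ : M) (u : ∀ x, E x) : M → E₀ :=
  fun x => (trivializationAt E₀ E x₀ (TotalSpace.mk' E₀ x (u x))).2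

/-- The section `u` vanishes at `x` together with its first derivatives. -/
def OneJetVanishesAt (u : SmoothSections I E₀ E) (x : M) : Prop :=
  u.1 x = 0 ∧ mfderiv I 𝓘(ℝ, E₀) (localRep E₀ x u.1) x = 0

/-- Compact support contained in the interior of the manifold. -/
def IsCC (u : SmoothSections I E₀ E) : Prop :=
  ∃ K : Set M, IsCompact K ∧ K ⊆ I.interior M ∧ ∀ x ∉ K, u.1 x = 0

variable (I E₀ E) in
/-- The fibrewise Hermitian inner products depend smoothly on the base point: together with the
inner product space structures on the fibres this makes `E` a Hermitian vector bundle. -/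
def IsSmoothHermitian : Prop :=
  ∀ u v : SmoothSections I E₀ E,
    ContMDiff I 𝓘(ℝ, ℂ) ∞ (fun x => inner ℂ (u.1 x) (v.1 x))

lemma contMDiffAt_localRep (u : SmoothSections I E₀ E) (x : M) :
    ContMDiffAt I 𝓘(ℝ, E₀) ∞ (localRep E₀ x u.1) x :=
  (contMDiffAt_section x).1 (u.2 x)

lemma localRep_self_eq_zero_iff (u : ∀ x, E x) (x : M) : localRep E₀ x u x = 0 ↔ u x = 0 := by
  have hx := mem_baseSet_trivializationAt E₀ E x
  have h : localRep E₀ x u x =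
      ((trivializationAt E₀ E x).continuousLinearEquivAt ℂ x hx) (u x) := by
    simp [localRep, Trivialization.continuousLinearEquivAt_apply]
  rw [h]
  exact map_eq_zero_iff _ (ContinuousLinearEquiv.injective _)

lemma hasMFDerivAt_smul_of_eq_zero {f : M → ℝ} {g : M → E₀} {x : M}
    {f' : TangentSpace I x →L[ℝ] ℝ} {g' : TangentSpace I x →L[ℝ] E₀}
    (hf : HasMFDerivAt I 𝓘(ℝ, ℝ) f x f') (hg : HasMFDerivAt I 𝓘(ℝ, E₀) g x g')
    (h₀ : f x = 0) (h : f' = 0 ∨ g x = 0) :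
    HasMFDerivAt I 𝓘(ℝ, E₀) (fun y => f y • g y) x (0 : TangentSpace I x →L[ℝ] E₀) := by
  refine ⟨hf.1.smul hg.1, ?_⟩
  have h2 := hf.2.smul hg.2
  refine h2.congr_fderiv ?_
  have hf₀ : writtenInExtChartAt I 𝓘(ℝ, ℝ) x f (extChartAt I x x) = 0 := by
    change f ((extChartAt I x).symm (extChartAt I x x)) = 0
    rw [extChartAt_to_inv, h₀]
  have hg₀ : writtenInExtChartAt I 𝓘(ℝ, E₀) x g (extChartAt I x x) = g x := by
    change g ((extChartAt I x).symm (extChartAt I x x)) = g x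
    rw [extChartAt_to_inv]
  rw [hf₀, hg₀]
  rcases h with h | h
  · subst h
    ext v
    exact (congrArg₂ (· + ·) (zero_smul ℝ _) (zero_smul ℝ _)).trans (add_zero _)
  · rw [h]
    ext v
    exact (congrArg₂ (· + ·) (zero_smul ℝ _) (smul_zero _)).trans (add_zero _)

lemma oneJetVanishesAt_mulFun {f : C^∞⟮I, M; ℝ⟯} {u : SmoothSections I E₀ E} {x : M}
    (hf : f x = 0) (h : mfderiv I 𝓘(ℝ, ℝ) f x = 0 ∨ u.1 x = 0) :
    OneJetVanishesAt (mulFun f u) x := by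
  refine ⟨by simp [mulFun, hf], ?_⟩
  have hev : localRep E₀ x (mulFun f u).1 =ᶠ[𝓝 x]
      fun y => f y • localRep E₀ x u.1 y := by
    filter_upwards [(trivializationAt E₀ E x).open_baseSet.mem_nhds
      (mem_baseSet_trivializationAt E₀ E x)] with y hy
    exact ((trivializationAt E₀ E x).linear ℝ hy).2 (f y) (u.1 y)
  rw [hev.mfderiv_eq]
  have hfd : HasMFDerivAt I 𝓘(ℝ, ℝ) f x (mfderiv I 𝓘(ℝ, ℝ) f x) :=
    (f.contMDiff.mdifferentiableAt (by simp)).hasMFDerivAt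
  have hud := ((contMDiffAt_localRep u x).mdifferentiableAt (by simp)).hasMFDerivAt
  exact (hasMFDerivAt_smul_of_eq_zero hfd hud hf
    (h.imp_right (localRep_self_eq_zero_iff u.1 x).2)).mfderiv

/-- There is a smooth function with prescribed differential at a point. -/
lemma exists_mfderiv_eq [T2Space M] [IsManifold I ∞ M] (x : M) (ξ : TangentSpace I x →L[ℝ] ℝ) :
    ∃ f : C^∞⟮I, M; ℝ⟯, (mfderiv I 𝓘(ℝ, ℝ) f x : TangentSpace I x →L[ℝ] ℝ) = ξ := by
  let ξ' : EuclideanSpace ℝ (Fin n) →L[ℝ] ℝ := ξ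
  obtain ⟨b⟩ : Nonempty (SmoothBumpFunction I x) := inferInstance
  have hg : ContMDiffOn I 𝓘(ℝ, ℝ) ∞ (fun y => ξ' (extChartAt I x y)) (chartAt H x).source :=
    ξ'.contMDiff.comp_contMDiffOn contMDiffOn_extChartAt
  refine ⟨⟨fun y => b y • ξ' (extChartAt I x y), b.contMDiff_smul hg⟩, ?_⟩
  have hev : (fun y => b y • ξ' (extChartAt I x y)) =ᶠ[𝓝 x] fun y => ξ' (extChartAt I x y) := by
    filter_upwards [b.eventuallyEq_one] with y hy
    simp [hy]
  have h1 := hasMFDerivAt_extChartAt (I := I) (mem_chart_source H x)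
  have h0 : HasMFDerivAt 𝓘(ℝ, EuclideanSpace ℝ (Fin n)) 𝓘(ℝ, ℝ) ξ' (extChartAt I x x) ξ' :=
    ξ'.hasFDerivAt.hasMFDerivAt
  refine Eq.trans ((h0.comp x h1).congr_of_eventuallyEq hev).mfderiv ?_
  refine ContinuousLinearMap.ext fun v => ?_
  have h4 : mfderiv I I (chartAt H x) x = tangentCoordChange I x x x :=
    mfderiv_chartAt_eq_tangentCoordChange (mem_chart_source H x)
  have h5 : tangentCoordChange I x x x v = v := tangentCoordChange_self (mem_extChartAt_source x)
  exact congrArg ξ' ((DFunLike.congr_fun h4 v).trans h5)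

/-- There is a smooth section with prescribed value at a point. -/
lemma exists_section_eq [T2Space M] [IsManifold I ∞ M] [ContMDiffVectorBundle ∞ E₀ E I]
    (x : M) (e : E x) : ∃ u : SmoothSections I E₀ E, u.1 x = e := by
  obtain ⟨s, hs, hsm⟩ := FiberBundle.exists_contMDiffOn_extend (𝕜 := ℝ) (k := ∞) I E₀ e
  obtain ⟨b, -, hb⟩ := (SmoothBumpFunction.nhds_basis_tsupport (I := I) x).mem_iff.1
    (interior_mem_nhds.2 hs)
  refine ⟨⟨_, ContMDiffOn.smul_section_of_tsupport (b.contMDiff.contMDiffOn) isOpen_interior hb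
    (hsm.mono interior_subset)⟩, ?_⟩
  simp

end Sections

/-! ### First-order differential operators, symbols, formal adjoints, extensions in `L²` -/

section Operators

variable {n : ℕ} {H : Type*} [TopologicalSpace H]
  {I : ModelWithCorners ℝ (EuclideanSpace ℝ (Fin n)) H}
  {M : Type*} [TopologicalSpace M] [ChartedSpace H M]
  {E₀ : Type*} [NormedAddCommGroup E₀] [NormedSpace ℂ E₀]
  {E : M → Type*} [TopologicalSpace (TotalSpace E₀ E)]
  [∀ x, NormedAddCommGroup (E x)] [∀ x, InnerProductSpace ℂ (E x)]
  [FiberBundle E₀ E] [VectorBundle ℂ E₀ E] [VectorBundle ℝ E₀ E]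
  {F₀ : Type*} [NormedAddCommGroup F₀] [NormedSpace ℂ F₀]
  {F : M → Type*} [TopologicalSpace (TotalSpace F₀ F)]
  [∀ x, NormedAddCommGroup (F x)] [∀ x, InnerProductSpace ℂ (F x)]
  [FiberBundle F₀ F] [VectorBundle ℂ F₀ F] [VectorBundle ℝ F₀ F]

/-- A linear operator `D : C^∞(M; E) → C^∞(M; F)` is a first-order differential operator if
`(D u)(x)` only depends on the one-jet of `u` at `x`. Equivalently, in local coordinates and
trivializations, `D = ∑ⱼ Aⱼ ∂ⱼ + B` with matrix-valued functions `Aⱼ`, `B`, which are automatically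
smooth because `D` maps smooth sections to smooth sections. -/
def IsFirstOrder (D : SmoothSections I E₀ E →ₗ[ℂ] SmoothSections I F₀ F) : Prop :=
  ∀ (u : SmoothSections I E₀ E) (x : M), OneJetVanishesAt u x → (D u).1 x = 0

/-- The commutator `[D, f]` applied to `u`, at the point `x`. -/
def commutatorAt (D : SmoothSections I E₀ E →ₗ[ℂ] SmoothSections I F₀ F) (f : C^∞⟮I, M; ℝ⟯)
    (u : SmoothSections I E₀ E) (x : M) : F x :=
  (D (mulFun f u)).1 x - f x • (D u).1 x

/-- The principal symbol `σ_D(x, ξ) : E_x → F_x` of a first-order operator: `σ_D(x, ξ) e` is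
`[D, f] u (x)` for any smooth function `f` with `df(x) = ξ` and any smooth section `u` with
`u(x) = e`. By `principalSymbol_apply` the choices of `f` and `u` do not matter. -/
def principalSymbol [T2Space M] [IsManifold I ∞ M] [ContMDiffVectorBundle ∞ E₀ E I]
    (D : SmoothSections I E₀ E →ₗ[ℂ] SmoothSections I F₀ F) (x : M)
    (ξ : TangentSpace I x →L[ℝ] ℝ) (e : E x) : F x :=
  commutatorAt D (exists_mfderiv_eq x ξ).choose
    (exists_section_eq (I := I) (E₀ := E₀) x e).choose x

/-- `[D, f] u (x)` only depends on `df(x)` and `u(x)`. -/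
lemma commutatorAt_congr {D : SmoothSections I E₀ E →ₗ[ℂ] SmoothSections I F₀ F}
    (hD : IsFirstOrder D) {f g : C^∞⟮I, M; ℝ⟯} {u v : SmoothSections I E₀ E} {x : M}
    (hfg : mfderiv I 𝓘(ℝ, ℝ) f x = mfderiv I 𝓘(ℝ, ℝ) g x) (huv : u.1 x = v.1 x) :
    commutatorAt D f u x = commutatorAt D g v x := by
  let s : C^∞⟮I, M; ℝ⟯ → C^∞⟮I, M; ℝ⟯ := fun h =>
    ⟨fun y => h y - h x, h.contMDiff.sub contMDiff_const⟩
  have key : ∀ (h : C^∞⟮I, M; ℝ⟯) (w : SmoothSections I E₀ E),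
      commutatorAt D h w x = (D (mulFun (s h) w)).1 x := by
    intro h w
    have h1 : mulFun (s h) w = mulFun h w - ((h x : ℝ) : ℂ) • w := by
      ext y
      exact (sub_smul (h y) (h x) (w.1 y)).trans (by simp [mulFun])
    rw [h1, map_sub, map_smul]
    simp [commutatorAt]
  have h1 : commutatorAt D f u x = commutatorAt D f v x := by
    rw [key, key, ← sub_eq_zero]
    have h3 : mulFun (s f) u - mulFun (s f) v = mulFun (s f) (u - v) := by
      ext y
      exact (smul_sub (s f y) (u.1 y) (v.1 y)).symm
    have h2 := hD _ x (oneJetVanishesAt_mulFun (f := s f) (u := u - v) (x := x)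
      (sub_self (f x)) (Or.inr (by simp [huv])))
    rw [← h3, map_sub] at h2
    exact h2
  have h2 : commutatorAt D f v x = commutatorAt D g v x := by
    rw [key, key, ← sub_eq_zero]
    let d : C^∞⟮I, M; ℝ⟯ :=
      ⟨fun y => (f y - f x) - (g y - g x),
        (f.contMDiff.sub contMDiff_const).sub (g.contMDiff.sub contMDiff_const)⟩
    have h3 : mulFun (s f) v - mulFun (s g) v = mulFun d v := by
      ext y
      exact (sub_smul (s f y) (s g y) (v.1 y)).symm
    have hf := (f.contMDiff.mdifferentiableAt (x := x) (by simp)).hasMFDerivAt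
    have hg := (g.contMDiff.mdifferentiableAt (x := x) (by simp)).hasMFDerivAt
    rw [← hfg] at hg
    have hd : HasMFDerivAt I 𝓘(ℝ, ℝ) d x (0 : TangentSpace I x →L[ℝ] ℝ) :=
      ⟨d.contMDiff.continuous.continuousAt,
        ((hf.2.sub_const (f x)).sub (hg.2.sub_const (g x))).congr_fderiv (sub_self _)⟩
    have h4 := hD _ x (oneJetVanishesAt_mulFun (f := d) (u := v) (x := x)
      (show (f x - f x) - (g x - g x) = 0 by simp) (Or.inl hd.mfderiv))
    rw [← h3, map_sub] at h4
    exact h4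
  exact h1.trans h2

theorem principalSymbol_apply [T2Space M] [IsManifold I ∞ M] [ContMDiffVectorBundle ∞ E₀ E I]
    {D : SmoothSections I E₀ E →ₗ[ℂ] SmoothSections I F₀ F} (hD : IsFirstOrder D)
    (f : C^∞⟮I, M; ℝ⟯) (u : SmoothSections I E₀ E) (x : M) :
    principalSymbol D x (mfderiv I 𝓘(ℝ, ℝ) f x) (u.1 x) = commutatorAt D f u x := by
  exact commutatorAt_congr hD (exists_mfderiv_eq (I := I) x (mfderiv I 𝓘(ℝ, ℝ) f x)).choose_spec
    (exists_section_eq (I := I) (E₀ := E₀) x (u.1 x)).choose_spec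

variable [MeasurableSpace M]

/-- `D†` is the formal adjoint of `D`: it is an operator `C^∞(M; F) → C^∞(M; E)` with
`⟨D u, v⟩ = ⟨u, D† v⟩` in `L²` for all smooth `u`, `v` such that the support of `u` is compact and
contained in the interior of `M`. Such an operator is unique. -/
def IsFormalAdjoint (μ : Measure M) (D : SmoothSections I E₀ E →ₗ[ℂ] SmoothSections I F₀ F)
    (Ddag : SmoothSections I F₀ F →ₗ[ℂ] SmoothSections I E₀ E) : Prop :=
  ∀ (u : SmoothSections I E₀ E) (v : SmoothSections I F₀ F), IsCC u →
    ∫ x, inner ℂ ((D u).1 x) (v.1 x) ∂μ = ∫ x, inner ℂ (u.1 x) ((Ddag v).1 x) ∂μ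

/-- Measurability of a (not necessarily continuous) section, up to null sets: measurability in
the local trivializations. -/
def AEMeasurableSection (E₀ : Type*) [NormedAddCommGroup E₀] [NormedSpace ℂ E₀]
    {E : M → Type*} [TopologicalSpace (TotalSpace E₀ E)]
    [∀ x, NormedAddCommGroup (E x)] [FiberBundle E₀ E]
    (μ : Measure M) (u : ∀ x, E x) : Prop :=
  ∀ x₀ : M, AEStronglyMeasurable (localRep E₀ x₀ u)
    (μ.restrict (trivializationAt E₀ E x₀).baseSet)

/-- The `L²` norm of a section, possibly infinite. -/
def l2Norm {E : M → Type*} [∀ x, NormedAddCommGroup (E x)] (μ : Measure M) (u : ∀ x, E x) :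
    ℝ≥0∞ :=
  (∫⁻ x, ‖u x‖ₑ ^ 2 ∂μ) ^ (1 / 2 : ℝ)

/-- `u` represents an element of `L²(M; E)`. -/
def MemL2 (E₀ : Type*) [NormedAddCommGroup E₀] [NormedSpace ℂ E₀]
    {E : M → Type*} [TopologicalSpace (TotalSpace E₀ E)]
    [∀ x, NormedAddCommGroup (E x)] [FiberBundle E₀ E]
    (μ : Measure M) (u : ∀ x, E x) : Prop :=
  AEMeasurableSection E₀ μ u ∧ l2Norm μ u < ⊤

/-- Let `T_cc` be the restriction of `T : C^∞(M; F) → C^∞(M; E)` to the smooth sections with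
compact support in the interior, an unbounded operator `L²(M; F) → L²(M; E)`. This is the graph of
its Hilbert space adjoint `(T_cc)* : L²(M; E) → L²(M; F)`: it contains `(u, w)` if
`u` is in the domain of `(T_cc)*` and `(T_cc)* u = w`. Elements of `L²` are represented by sections,
and equality is equality almost everywhere. -/
def adjointGraph (μ : Measure M) (T : SmoothSections I F₀ F →ₗ[ℂ] SmoothSections I E₀ E) :
    Set ((∀ x, E x) × (∀ x, F x)) :=
  {q | MemL2 E₀ μ q.1 ∧ MemL2 F₀ μ q.2 ∧
    ∀ φ : SmoothSections I F₀ F, IsCC φ →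
      ∫ x, inner ℂ ((T φ).1 x) (q.1 x) ∂μ = ∫ x, inner ℂ (φ.1 x) (q.2 x) ∂μ}

/-- The graph of the maximal extension `D_max = (D†)*` of the operator `D` with formal adjoint
`D†`, as a set of pairs `(u, D_max u)`. -/
def maxGraph (μ : Measure M) (Ddag : SmoothSections I F₀ F →ₗ[ℂ] SmoothSections I E₀ E) :
    Set ((∀ x, E x) × (∀ x, F x)) :=
  adjointGraph μ Ddag

/-- The graph norm `(‖u‖² + ‖w‖²)^{1/2}` of a pair `(u, w)` of sections. -/
def graphNorm {E F : M → Type*} [∀ x, NormedAddCommGroup (E x)] [∀ x, NormedAddCommGroup (F x)]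
    (μ : Measure M) (q : (∀ x, E x) × (∀ x, F x)) : ℝ≥0∞ :=
  (l2Norm μ q.1 ^ 2 + l2Norm μ q.2 ^ 2) ^ (1 / 2 : ℝ)

/-- An operator given by its graph is complete if the compactly supported elements of its domain
are dense in its domain for the graph norm. The supports are compact subsets of `M`, which may
meet the boundary. -/
def IsComplete {E F : M → Type*} [∀ x, NormedAddCommGroup (E x)]
    [∀ x, NormedAddCommGroup (F x)] (μ : Measure M) (G : Set ((∀ x, E x) × (∀ x, F x))) : Prop :=
  ∀ q ∈ G, ∀ ε : ℝ, 0 < ε → ∃ q' ∈ G,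
    (∃ K : Set M, IsCompact K ∧ ∀ x ∉ K, q'.1 x = 0) ∧
    graphNorm μ (q - q') < ENNReal.ofReal ε

end Operators

end FirstOrderCompleteness

end

/-
The commutator of `D` with a real function `f` is multiplication by `σ_D(x, df(x))`. On a complete
Riemannian manifold closed balls are compact, and the distance from `p` is within distance `1` of a
smooth function `f₀` with `|df₀| ≤ 5`. Composing `f₀ + 1` with a smooth primitive `h`, tending to
infinity, of a function bounded by `1 / C` gives a smooth exhaustion `ρ` of `M` with
`|σ_D(x, dρ(x))| ≤ 5`. The cutoffs `χ_k = θ (ρ / k)` then satisfy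
`|σ_D(x, dχ_k(x))| = O(1 / k)`, so that `χ_k u → u` in the graph norm for every `u` in the maximal
domain of `D` or of `D†`.
-/

noncomputable section

namespace FirstOrderCompleteness

open Filter

/-! ### Smooth measures -/

section ChartImages

variable {V : Type*} [NormedAddCommGroup V] [NormedSpace ℝ V] {H : Type*} [TopologicalSpace H]
  {I : ModelWithCorners ℝ V H} {M : Type*} [TopologicalSpace M] [ChartedSpace H M]

lemma extChartAt_image_eq (x₀ : M) (s : Set M) :
    extChartAt I x₀ '' s = I.symm ⁻¹' (chartAt H x₀ '' s) ∩ range I := by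
  rw [← I.image_eq, ← image_comp, extChartAt_coe]

lemma measurableSet_extChartAt_image [MeasurableSpace V] [BorelSpace V] {x₀ : M} {s : Set M}
    (hs : IsOpen s) (hsub : s ⊆ (chartAt H x₀).source) :
    MeasurableSet (extChartAt I x₀ '' s) := by
  rw [extChartAt_image_eq]
  exact (((chartAt H x₀).isOpen_image_of_subset_source hs hsub).preimage
    I.continuous_symm).measurableSet.inter I.isClosed_range.measurableSet

lemma nonempty_interior_extChartAt_image {x₀ : M} {s : Set M} (hs : IsOpen s)
    (hsub : s ⊆ (chartAt H x₀).source) (hne : s.Nonempty) :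
    (interior (extChartAt I x₀ '' s)).Nonempty := by
  obtain ⟨x, hx⟩ := hne
  have hO : IsOpen (I.symm ⁻¹' (chartAt H x₀ '' s)) :=
    ((chartAt H x₀).isOpen_image_of_subset_source hs hsub).preimage I.continuous_symm
  have hmem : I (chartAt H x₀ x) ∈ closure (interior (range I)) :=
    I.range_subset_closure_interior (mem_range_self _)
  obtain ⟨y, hy⟩ := mem_closure_iff.1 hmem _ hO (by simpa using mem_image_of_mem _ hx)
  rw [extChartAt_image_eq, interior_inter, hO.interior_eq]
  exact ⟨y, hy⟩

/-- Boundary points are limits of interior points because a model with corners has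
`range I ⊆ closure (interior (range I))`. -/
lemma dense_interior [FiniteDimensional ℝ V] [IsManifold I 1 M] : Dense (I.interior M) := by
  rw [dense_iff_inter_open]
  rintro U hU ⟨x₀, hx₀⟩
  obtain ⟨y, hy⟩ := nonempty_interior_extChartAt_image (I := I)
    (hU.inter (chartAt H x₀).open_source) inter_subset_right ⟨x₀, hx₀, mem_chart_source H x₀⟩
  obtain ⟨x, hx, rfl⟩ := interior_subset hy
  refine ⟨x, hx.1, ?_⟩
  refine (I.isInteriorPoint_iff_of_mem_atlas one_ne_zero (chart_mem_atlas H x₀) hx.2).2 ?_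
  refine interior_mono ?_ hy
  rintro _ ⟨z, hz, rfl⟩
  exact (extChartAt I x₀).map_source (by simpa using hz.2)

end ChartImages

section SmoothMeasure

variable {n : ℕ} {H : Type*} [TopologicalSpace H]
  {I : ModelWithCorners ℝ (EuclideanSpace ℝ (Fin n)) H}
  {M : Type*} [TopologicalSpace M] [ChartedSpace H M] [MeasurableSpace M] [BorelSpace M]
  {μ : Measure M}

lemma IsSmoothMeasure.isLocallyFiniteMeasure (hμ : IsSmoothMeasure I μ) :
    IsLocallyFiniteMeasure μ := by
  refine ⟨fun x₀ => ?_⟩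
  obtain ⟨ρ, hρ, -, h⟩ := hμ x₀
  set y₀ := extChartAt I x₀ x₀
  obtain ⟨O, hO, hyO, hρO⟩ : ∃ O, IsOpen O ∧ y₀ ∈ O ∧
      O ∩ (extChartAt I x₀).target ⊆ ρ ⁻¹' Iio (ρ y₀ + 1) :=
    mem_nhdsWithin.1 (hρ.continuousOn y₀ (mem_extChartAt_target x₀)
      (Iio_mem_nhds (lt_add_one (ρ y₀))))
  let s := (extChartAt I x₀).source ∩ extChartAt I x₀ ⁻¹' (O ∩ Metric.ball y₀ 1)
  have hs : IsOpen s := isOpen_extChartAt_preimage' x₀ (hO.inter Metric.isOpen_ball)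
  refine ⟨s, hs.mem_nhds ⟨mem_extChartAt_source x₀, hyO, Metric.mem_ball_self one_pos⟩, ?_⟩
  have hA : MeasurableSet (extChartAt I x₀ '' s) :=
    measurableSet_extChartAt_image hs (by simp [s])
  calc μ s = ∫⁻ y in extChartAt I x₀ '' s, ENNReal.ofReal (ρ y) :=
        h s inter_subset_left hs.measurableSet
    _ ≤ ∫⁻ _ in extChartAt I x₀ '' s, ENNReal.ofReal (ρ y₀ + 1) := by
        refine setLIntegral_mono' hA ?_
        rintro _ ⟨x, hx, rfl⟩
        exact ENNReal.ofReal_le_ofReal (hρO ⟨hx.2.1, (extChartAt I x₀).map_source hx.1⟩).le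
    _ ≤ ENNReal.ofReal (ρ y₀ + 1) * volume (Metric.ball y₀ 1) := by
        rw [setLIntegral_const]
        gcongr
        rintro _ ⟨x, hx, rfl⟩
        exact hx.2.2
    _ < ⊤ := ENNReal.mul_lt_top ENNReal.ofReal_lt_top measure_ball_lt_top

lemma IsSmoothMeasure.isOpenPosMeasure (hμ : IsSmoothMeasure I μ) : μ.IsOpenPosMeasure := by
  refine ⟨fun U hU ⟨x₀, hx₀⟩ h0 => ?_⟩
  obtain ⟨ρ, hρ, hpos, h⟩ := hμ x₀
  let s := U ∩ (chartAt H x₀).source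
  have hs : IsOpen s := hU.inter (chartAt H x₀).open_source
  have hsub : s ⊆ (extChartAt I x₀).source := by simp [s]
  have hsub' : extChartAt I x₀ '' s ⊆ (extChartAt I x₀).target :=
    ((extChartAt I x₀).mapsTo.mono_left hsub).image_subset
  have hA : MeasurableSet (extChartAt I x₀ '' s) :=
    measurableSet_extChartAt_image hs inter_subset_right
  have hs0 : μ s = 0 := measure_mono_null inter_subset_left h0
  rw [h s hsub hs.measurableSet, lintegral_eq_zero_iff'
    ((hρ.continuousOn.mono hsub').aemeasurable hA).ennreal_ofReal,
    EventuallyEq, ae_restrict_iff' hA] at hs0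
  have hvol : volume (extChartAt I x₀ '' s) = 0 :=
    measure_eq_zero_iff_ae_notMem.2 <| hs0.mono fun y hy hyA =>
      (hpos y (hsub' hyA)).not_ge (ENNReal.ofReal_eq_zero.1 (hy hyA))
  have hne := nonempty_interior_extChartAt_image (I := I) hs inter_subset_right
    ⟨x₀, hx₀, mem_chart_source H x₀⟩
  exact (isOpen_interior.measure_pos volume hne).ne' (measure_mono_null interior_subset hvol)

/-- The conclusion holds up to the boundary, although the test functions are supported in the
interior. -/
lemma IsSmoothMeasure.eqOn_zero_of_integral_smul_eq_zero [IsManifold I ∞ M] [T2Space M]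
    [SigmaCompactSpace M] {G : Type*} [NormedAddCommGroup G] [NormedSpace ℝ G] [CompleteSpace G]
    (hμ : IsSmoothMeasure I μ) {g : M → G} (hg : Continuous g) {U : Set M} (hU : IsOpen U)
    (h : ∀ b : C^∞⟮I, M; ℝ⟯, HasCompactSupport b → tsupport b ⊆ U ∩ I.interior M →
      ∫ x, b x • g x ∂μ = 0) :
    EqOn g 0 U := by
  have := hμ.isLocallyFiniteMeasure
  have := hμ.isOpenPosMeasure
  have : IsManifold I 1 M := IsManifold.of_le (n := ∞) (by simp)
  have := I.secondCountableTopology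
  have := ChartedSpace.secondCountable_of_sigmaCompact H M
  have hUi : IsOpen (U ∩ I.interior M) := hU.inter (I.isOpen_interior one_ne_zero)
  have hae : ∀ᵐ x ∂μ, x ∈ U ∩ I.interior M → g x = 0 :=
    hUi.ae_eq_zero_of_integral_contMDiff_smul_eq_zero I
      (hg.locallyIntegrable.locallyIntegrableOn _) fun b hb hbc hbs => h ⟨b, hb⟩ hbc hbs
  have hEq : EqOn g 0 (U ∩ I.interior M) := by
    refine Measure.eqOn_open_of_ae_eq (μ := μ) ?_ hUi hg.continuousOn continuousOn_const
    rwa [EventuallyEq, ae_restrict_iff' hUi.measurableSet]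
  exact (hEq.closure hg continuous_const).mono (dense_interior.open_subset_closure_inter hU)

end SmoothMeasure

/-! ### Local frames and measurability of sections -/

section LocalRep

variable {M : Type*} [TopologicalSpace M]
  {E₀ : Type*} [NormedAddCommGroup E₀] [NormedSpace ℂ E₀]
  {E : M → Type*} [TopologicalSpace (TotalSpace E₀ E)]
  [∀ x, NormedAddCommGroup (E x)] [∀ x, InnerProductSpace ℂ (E x)]
  [FiberBundle E₀ E] [VectorBundle ℂ E₀ E]

lemma localRep_eq_linearMapAt {x₀ x : M} (hx : x ∈ (trivializationAt E₀ E x₀).baseSet)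
    (u : ∀ x, E x) :
    localRep E₀ x₀ u x = (trivializationAt E₀ E x₀).linearMapAt ℂ x (u x) := by
  rw [Trivialization.coe_linearMapAt_of_mem _ hx]
  rfl

variable (E₀) in
lemma finiteDimensional_fiber [FiniteDimensional ℂ E₀] (x : M) : FiniteDimensional ℂ (E x) :=
  LinearEquiv.finiteDimensional ((trivializationAt E₀ E x).continuousLinearEquivAt ℂ x
    (mem_baseSet_trivializationAt E₀ E x)).symm.toLinearEquiv

lemma AEMeasurableSection.add [MeasurableSpace M] [OpensMeasurableSpace M] {μ : Measure M}
    {u v : ∀ x, E x} (hu : AEMeasurableSection E₀ μ u) (hv : AEMeasurableSection E₀ μ v) :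
    AEMeasurableSection E₀ μ (u + v) := by
  intro x₀
  refine ((hu x₀).add (hv x₀)).congr ?_
  filter_upwards [ae_restrict_mem (trivializationAt E₀ E x₀).open_baseSet.measurableSet] with x hx
  simp [localRep_eq_linearMapAt hx]

end LocalRep

lemma aestronglyMeasurable_restrict_of_locally {X G : Type*} [TopologicalSpace X]
    [SecondCountableTopology X] [MeasurableSpace X] {μ : Measure X} [TopologicalSpace G]
    [TopologicalSpace.PseudoMetrizableSpace G] {U : Set X} {f : X → G}
    (h : ∀ y ∈ U, ∃ V ∈ 𝓝[U] y, AEStronglyMeasurable f (μ.restrict V)) :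
    AEStronglyMeasurable f (μ.restrict U) := by
  choose! V hV hf using h
  obtain ⟨T, hTU, hT, hcover⟩ := TopologicalSpace.countable_cover_nhdsWithin hV
  have := hT.to_subtype
  rw [biUnion_eq_iUnion] at hcover
  exact (aestronglyMeasurable_iUnion_iff.2 fun y : T => hf y (hTU y.2)).mono_set hcover

section MeasurableSections

variable {n : ℕ} {H : Type*} [TopologicalSpace H]
  {I : ModelWithCorners ℝ (EuclideanSpace ℝ (Fin n)) H}
  {M : Type*} [TopologicalSpace M] [ChartedSpace H M]
  {E₀ : Type*} [NormedAddCommGroup E₀] [NormedSpace ℂ E₀]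
  {E : M → Type*} [TopologicalSpace (TotalSpace E₀ E)]
  [∀ x, NormedAddCommGroup (E x)] [∀ x, InnerProductSpace ℂ (E x)]
  [FiberBundle E₀ E] [VectorBundle ℂ E₀ E] [VectorBundle ℝ E₀ E]
  {F₀ : Type*} [NormedAddCommGroup F₀] [NormedSpace ℂ F₀]
  {F : M → Type*} [TopologicalSpace (TotalSpace F₀ F)]
  [∀ x, NormedAddCommGroup (F x)] [∀ x, InnerProductSpace ℂ (F x)]
  [FiberBundle F₀ F] [VectorBundle ℂ F₀ F] [VectorBundle ℝ F₀ F]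

variable (I E₀ F₀) in
/-- A fibrewise linear map `E → F` is a smooth bundle homomorphism if it maps smooth sections to
smooth sections. -/
def IsSmoothHom (B : ∀ x, E x →ₗ[ℂ] F x) : Prop :=
  ∀ s : SmoothSections I E₀ E, (fun x => B x (s.1 x)) ∈ SmoothSections I F₀ F

lemma continuousOn_localRep [ContMDiffVectorBundle ∞ E₀ E I] (s : SmoothSections I E₀ E) (x₀ : M) :
    ContinuousOn (localRep E₀ x₀ s.1) (trivializationAt E₀ E x₀).baseSet :=
  ((trivializationAt E₀ E x₀).contMDiffOn_section_baseSet_iff.1 s.2.contMDiffOn).continuousOn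

lemma IsSmoothHermitian.continuous_norm (hE : IsSmoothHermitian I E₀ E)
    (s : SmoothSections I E₀ E) : Continuous fun x => ‖s.1 x‖ := by
  simp_rw [norm_eq_sqrt_re_inner (𝕜 := ℂ)]
  exact (Complex.continuous_re.comp (hE s s).continuous).sqrt

variable [T2Space M] [IsManifold I ∞ M] [ContMDiffVectorBundle ∞ E₀ E I]

lemma exists_smoothSections_frame {ι : Type*} [Fintype ι] (b : Module.Basis ι ℂ E₀) (y : M) :
    ∃ s : ι → SmoothSections I E₀ E, ∀ᶠ x in 𝓝 y, x ∈ (trivializationAt E₀ E y).baseSet ∧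
      ∀ u : ∀ x, E x, u x = ∑ i, b.repr (localRep E₀ y u x) i • (s i).1 x := by
  set e := trivializationAt E₀ E y
  have hbase : e.baseSet ∈ 𝓝 y := e.open_baseSet.mem_nhds (mem_baseSet_trivializationAt E₀ E y)
  obtain ⟨f, -, hf⟩ := (SmoothBumpFunction.nhds_basis_tsupport (I := I) y).mem_iff.1 hbase
  have hsmooth (i : ι) : ContMDiffOn I (I.prod 𝓘(ℝ, E₀)) ∞
      (fun x => TotalSpace.mk' E₀ x (e.symm x (b i))) e.baseSet := by
    rw [e.contMDiffOn_section_baseSet_iff]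
    refine (contMDiffOn_const (c := b i)).congr fun x hx => ?_
    simp [e.apply_mk_symm hx]
  refine ⟨fun i => ⟨_, ContMDiffOn.smul_section_of_tsupport f.contMDiff.contMDiffOn e.open_baseSet
    hf (hsmooth i)⟩, ?_⟩
  filter_upwards [hbase, f.eventuallyEq_one] with x hx hfx
  refine ⟨hx, fun u => ?_⟩
  have hframe (i : ι) : ((f : M → ℝ) • fun x => e.symm x (b i)) x = e.symmₗ ℂ x (b i) := by
    simp [e.symmₗ_apply hx, hfx]
  calc u x = e.symmₗ ℂ x (localRep E₀ y u x) := by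
        rw [localRep_eq_linearMapAt hx, e.symmₗ_linearMapAt hx]
    _ = ∑ i, b.repr (localRep E₀ y u x) i • e.symmₗ ℂ x (b i) := by
        conv_lhs => rw [← b.sum_repr (localRep E₀ y u x), map_sum]
        simp only [map_smul]
    _ = _ := by simp only [hframe]

variable [MeasurableSpace M] {μ : Measure M} [FiniteDimensional ℂ E₀]

lemma AEMeasurableSection.exists_eq_sum_smul {u : ∀ x, E x} (hu : AEMeasurableSection E₀ μ u)
    (y : M) :
    ∃ V, IsOpen V ∧ y ∈ V ∧ ∃ (a : Fin (Module.finrank ℂ E₀) → M → ℂ)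
      (s : Fin (Module.finrank ℂ E₀) → SmoothSections I E₀ E),
      (∀ i, AEStronglyMeasurable (a i) (μ.restrict V)) ∧
      ∀ x ∈ V, u x = ∑ i, a i x • (s i).1 x := by
  let b := Module.finBasis ℂ E₀
  obtain ⟨s, hs⟩ := exists_smoothSections_frame (I := I) (E := E) b y
  obtain ⟨V, hV, hVo, hyV⟩ := eventually_nhds_iff.1 hs
  refine ⟨V, hVo, hyV, fun i x => b.repr (localRep E₀ y u x) i, s, fun i => ?_,
    fun x hx => (hV x hx).2 u⟩
  have hcoord : Continuous (b.coord i) := LinearMap.continuous_of_finiteDimensional _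
  exact hcoord.comp_aestronglyMeasurable ((hu y).mono_set fun x hx => (hV x hx).1)

variable [BorelSpace M] [SecondCountableTopology M]

lemma AEMeasurableSection.apply {G : Type*} [NormedAddCommGroup G] [NormedSpace ℂ G]
    {U : Set M} (hU : IsOpen U) {ℓ : ∀ x, E x →ₗ[ℂ] G}
    (hℓ : ∀ s : SmoothSections I E₀ E,
      AEStronglyMeasurable (fun x => ℓ x (s.1 x)) (μ.restrict U))
    {u : ∀ x, E x} (hu : AEMeasurableSection E₀ μ u) :
    AEStronglyMeasurable (fun x => ℓ x (u x)) (μ.restrict U) := by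
  refine aestronglyMeasurable_restrict_of_locally fun y hy => ?_
  obtain ⟨V, hV, hyV, a, s, ha, hu⟩ := hu.exists_eq_sum_smul (I := I) y
  refine ⟨V ∩ U, mem_nhdsWithin_of_mem_nhds ((hV.inter hU).mem_nhds ⟨hyV, hy⟩), ?_⟩
  have hsum : AEStronglyMeasurable (fun x => ∑ i, a i x • ℓ x ((s i).1 x)) (μ.restrict (V ∩ U)) :=
    Finset.aestronglyMeasurable_fun_sum _ fun i _ =>
      ((ha i).mono_set inter_subset_left).smul ((hℓ (s i)).mono_set inter_subset_right)
  refine hsum.congr ?_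
  filter_upwards [ae_restrict_mem (hV.inter hU).measurableSet] with x hx
  simp only [hu x hx.1, map_sum, map_smul]

lemma AEMeasurableSection.map [ContMDiffVectorBundle ∞ F₀ F I] {B : ∀ x, E x →ₗ[ℂ] F x}
    (hB : IsSmoothHom I E₀ F₀ B) {u : ∀ x, E x} (hu : AEMeasurableSection E₀ μ u) :
    AEMeasurableSection F₀ μ (fun x => B x (u x)) := by
  intro x₀
  set e := trivializationAt F₀ F x₀
  have hm : MeasurableSet e.baseSet := e.open_baseSet.measurableSet
  have h := hu.apply (I := I) e.open_baseSet (ℓ := fun x => e.linearMapAt ℂ x ∘ₗ B x) fun s => by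
    refine ((continuousOn_localRep ⟨_, hB s⟩ x₀).aestronglyMeasurable hm).congr ?_
    filter_upwards [ae_restrict_mem hm] with x hx
    exact localRep_eq_linearMapAt hx fun x => B x (s.1 x)
  refine h.congr ?_
  filter_upwards [ae_restrict_mem hm] with x hx
  exact (localRep_eq_linearMapAt hx fun x => B x (u x)).symm

lemma AEMeasurableSection.inner_smooth (hE : IsSmoothHermitian I E₀ E) {u : ∀ x, E x}
    (hu : AEMeasurableSection E₀ μ u) (s : SmoothSections I E₀ E) :
    AEStronglyMeasurable (fun x => inner ℂ (s.1 x) (u x)) μ := by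
  simpa using hu.apply (I := I) (μ := μ) isOpen_univ (ℓ := fun x => (innerSL ℂ (s.1 x)).toLinearMap)
    fun t => (hE s t).continuous.aestronglyMeasurable

lemma AEMeasurableSection.norm (hE : IsSmoothHermitian I E₀ E) {u : ∀ x, E x}
    (hu : AEMeasurableSection E₀ μ u) : AEStronglyMeasurable (fun x => ‖u x‖) μ := by
  have hsq : AEStronglyMeasurable (fun x => inner ℂ (u x) (u x)) (μ.restrict univ) := by
    refine aestronglyMeasurable_restrict_of_locally fun y _ => ?_
    obtain ⟨V, hV, hyV, a, s, ha, hus⟩ := hu.exists_eq_sum_smul (I := I) y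
    refine ⟨V, mem_nhdsWithin_of_mem_nhds (hV.mem_nhds hyV), ?_⟩
    have hsum : AEStronglyMeasurable
        (fun x => ∑ i, (starRingEnd ℂ) (a i x) * inner ℂ ((s i).1 x) (u x)) (μ.restrict V) :=
      Finset.aestronglyMeasurable_fun_sum _ fun i _ =>
        (Complex.continuous_conj.comp_aestronglyMeasurable (ha i)).mul
          (hu.inner_smooth hE (s i)).restrict
    refine hsum.congr ?_
    filter_upwards [ae_restrict_mem hV.measurableSet] with x hx
    conv_rhs => rw [hus x hx, sum_inner, ← hus x hx]
    simp only [inner_smul_left]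
  rw [Measure.restrict_univ] at hsq
  simp_rw [norm_eq_sqrt_re_inner (𝕜 := ℂ)]
  exact (Real.continuous_sqrt.comp Complex.continuous_re).comp_aestronglyMeasurable hsq

end MeasurableSections

/-! ### Commutators and formal adjoints -/

section Commutators

variable {n : ℕ} {H : Type*} [TopologicalSpace H]
  {I : ModelWithCorners ℝ (EuclideanSpace ℝ (Fin n)) H}
  {M : Type*} [TopologicalSpace M] [ChartedSpace H M]
  {E₀ : Type*} [NormedAddCommGroup E₀] [NormedSpace ℂ E₀]
  {E : M → Type*} [TopologicalSpace (TotalSpace E₀ E)]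
  [∀ x, NormedAddCommGroup (E x)] [∀ x, InnerProductSpace ℂ (E x)]
  [FiberBundle E₀ E] [VectorBundle ℂ E₀ E] [VectorBundle ℝ E₀ E]
  {F₀ : Type*} [NormedAddCommGroup F₀] [NormedSpace ℂ F₀]
  {F : M → Type*} [TopologicalSpace (TotalSpace F₀ F)]
  [∀ x, NormedAddCommGroup (F x)] [∀ x, InnerProductSpace ℂ (F x)]
  [FiberBundle F₀ F] [VectorBundle ℂ F₀ F] [VectorBundle ℝ F₀ F]

/-- An operator on smooth sections is local if it does not increase supports. -/
def IsLocal (T : SmoothSections I E₀ E →ₗ[ℂ] SmoothSections I F₀ F) : Prop :=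
  ∀ (u : SmoothSections I E₀ E) (x : M), (∀ᶠ y in 𝓝 x, u.1 y = 0) → (T u).1 x = 0

lemma IsLocal.eq_zero_of_notMem {T : SmoothSections I E₀ E →ₗ[ℂ] SmoothSections I F₀ F}
    (hT : IsLocal T) {u : SmoothSections I E₀ E} {K : Set M} (hK : IsClosed K)
    (hu : ∀ x ∉ K, u.1 x = 0) : ∀ x ∉ K, (T u).1 x = 0 := fun x hx =>
  hT u x (eventually_of_mem (hK.isOpen_compl.mem_nhds hx) hu)

lemma IsFirstOrder.isLocal {D : SmoothSections I E₀ E →ₗ[ℂ] SmoothSections I F₀ F}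
    (hD : IsFirstOrder D) : IsLocal D := by
  intro u x hu
  refine hD u x ⟨hu.self_of_nhds, ?_⟩
  have hev : localRep E₀ x u.1 =ᶠ[𝓝 x] fun _ => 0 := by
    filter_upwards [hu, (trivializationAt E₀ E x).open_baseSet.mem_nhds
      (mem_baseSet_trivializationAt E₀ E x)] with y hy hyb
    rw [localRep_eq_linearMapAt hyb, hy, map_zero]
  rw [hev.mfderiv_eq, mfderiv_const]
  rfl

lemma mulFun_apply (f : C^∞⟮I, M; ℝ⟯) (u : SmoothSections I E₀ E) (x : M) :
    (mulFun f u).1 x = f x • u.1 x := rfl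

lemma mulFun_add (f : C^∞⟮I, M; ℝ⟯) (u v : SmoothSections I E₀ E) :
    mulFun f (u + v) = mulFun f u + mulFun f v := by
  ext x
  exact smul_add (f x) (u.1 x) (v.1 x)

lemma mulFun_smul (f : C^∞⟮I, M; ℝ⟯) (c : ℂ) (u : SmoothSections I E₀ E) :
    mulFun f (c • u) = c • mulFun f u := by
  ext x
  exact smul_comm (f x) c (u.1 x)

lemma mulFun_eq_zero_of_notMem {f : C^∞⟮I, M; ℝ⟯} (u : SmoothSections I E₀ E) {x : M}
    (hx : x ∉ tsupport f) : (mulFun f u).1 x = 0 := by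
  rw [mulFun_apply, image_eq_zero_of_notMem_tsupport hx, zero_smul]

lemma IsCC.mulFun {u : SmoothSections I E₀ E} (hu : IsCC u) (f : C^∞⟮I, M; ℝ⟯) :
    IsCC (mulFun f u) := by
  obtain ⟨K, hK, hKM, huK⟩ := hu
  exact ⟨K, hK, hKM, fun x hx => by rw [mulFun_apply, huK x hx, smul_zero]⟩

lemma isCC_mulFun {b : C^∞⟮I, M; ℝ⟯} (hb : HasCompactSupport b)
    (hbM : tsupport b ⊆ I.interior M) (u : SmoothSections I E₀ E) : IsCC (mulFun b u) :=
  ⟨tsupport b, hb, hbM, fun _ => mulFun_eq_zero_of_notMem u⟩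

/-- The commutator `[T, f]` as a map from smooth sections to smooth sections. -/
def commutatorSection (T : SmoothSections I E₀ E →ₗ[ℂ] SmoothSections I F₀ F) (f : C^∞⟮I, M; ℝ⟯)
    (u : SmoothSections I E₀ E) : SmoothSections I F₀ F :=
  T (mulFun f u) - mulFun f (T u)

lemma commutatorAt_add (T : SmoothSections I E₀ E →ₗ[ℂ] SmoothSections I F₀ F)
    (f : C^∞⟮I, M; ℝ⟯) (u v : SmoothSections I E₀ E) (x : M) :
    commutatorAt T f (u + v) x = commutatorAt T f u x + commutatorAt T f v x := by
  simp only [commutatorAt, mulFun_add, map_add, Submodule.coe_add, Pi.add_apply, smul_add]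
  abel

lemma commutatorAt_smul (T : SmoothSections I E₀ E →ₗ[ℂ] SmoothSections I F₀ F)
    (f : C^∞⟮I, M; ℝ⟯) (c : ℂ) (u : SmoothSections I E₀ E) (x : M) :
    commutatorAt T f (c • u) x = c • commutatorAt T f u x := by
  simp only [commutatorAt, mulFun_smul, map_smul, Submodule.coe_smul, Pi.smul_apply, smul_sub]
  rw [smul_comm c (f x)]

lemma IsFirstOrder.commutatorAt_mulFun {D : SmoothSections I E₀ E →ₗ[ℂ] SmoothSections I F₀ F}
    (hD : IsFirstOrder D) (f b : C^∞⟮I, M; ℝ⟯) (u : SmoothSections I E₀ E) (x : M) :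
    commutatorAt D f (mulFun b u) x = b x • commutatorAt D f u x :=
  calc commutatorAt D f (mulFun b u) x = commutatorAt D f (((b x : ℝ) : ℂ) • u) x :=
        commutatorAt_congr hD rfl (by simp [mulFun_apply])
    _ = b x • commutatorAt D f u x := by rw [commutatorAt_smul, Complex.coe_smul]

section Symbol

variable [T2Space M] [IsManifold I ∞ M] [ContMDiffVectorBundle ∞ E₀ E I]

/-- The principal symbol `σ_D(x, df(x)) : E_x → F_x` as a linear map. -/
def symbolMap {D : SmoothSections I E₀ E →ₗ[ℂ] SmoothSections I F₀ F} (hD : IsFirstOrder D)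
    (f : C^∞⟮I, M; ℝ⟯) (x : M) : E x →ₗ[ℂ] F x where
  toFun e := principalSymbol D x (mvfderiv I f x) e
  map_add' e e' := by
    obtain ⟨u, rfl⟩ := exists_section_eq (I := I) (E₀ := E₀) x e
    obtain ⟨v, rfl⟩ := exists_section_eq (I := I) (E₀ := E₀) x e'
    exact (principalSymbol_apply hD f (u + v) x).trans
      ((commutatorAt_add D f u v x).trans (congrArg₂ (· + ·) (principalSymbol_apply hD f u x)
        (principalSymbol_apply hD f v x)).symm)
  map_smul' c e := by
    obtain ⟨u, rfl⟩ := exists_section_eq (I := I) (E₀ := E₀) x e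
    exact (principalSymbol_apply hD f (c • u) x).trans
      ((commutatorAt_smul D f c u x).trans (congrArg (c • ·) (principalSymbol_apply hD f u x)).symm)

lemma symbolMap_apply {D : SmoothSections I E₀ E →ₗ[ℂ] SmoothSections I F₀ F}
    (hD : IsFirstOrder D) (f : C^∞⟮I, M; ℝ⟯) (u : SmoothSections I E₀ E) (x : M) :
    symbolMap hD f x (u.1 x) = commutatorAt D f u x :=
  principalSymbol_apply hD f u x

lemma IsFirstOrder.principalSymbol_smul
    {D : SmoothSections I E₀ E →ₗ[ℂ] SmoothSections I F₀ F} (hD : IsFirstOrder D) (x : M) (c : ℝ)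
    (ξ : TangentSpace I x →L[ℝ] ℝ) (e : E x) :
    principalSymbol D x (c • ξ) e = c • principalSymbol D x ξ e := by
  obtain ⟨f, hf⟩ := exists_mfderiv_eq (I := I) x ξ
  obtain ⟨u, rfl⟩ := exists_section_eq (I := I) (E₀ := E₀) x e
  have hcf : (mfderiv I 𝓘(ℝ, ℝ) (c • f : C^∞⟮I, M; ℝ⟯) x : TangentSpace I x →L[ℝ] ℝ) = c • ξ :=
    hf ▸ const_smul_mfderiv (f.contMDiff.mdifferentiableAt (by simp)) c
  have hmul : mulFun (c • f) u = (c : ℂ) • mulFun f u := by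
    ext y
    simp [mulFun_apply, mul_smul]
  rw [← hcf, ← hf, principalSymbol_apply hD, principalSymbol_apply hD]
  simp only [commutatorAt, hmul, map_smul, Submodule.coe_smul, Pi.smul_apply, Complex.coe_smul,
    ContMDiffMap.coe_smul, smul_sub, smul_assoc]

end Symbol

variable [MeasurableSpace M] {μ : Measure M}
  {D : SmoothSections I E₀ E →ₗ[ℂ] SmoothSections I F₀ F}
  {Ddag : SmoothSections I F₀ F →ₗ[ℂ] SmoothSections I E₀ E}

section Integrals

variable [T2Space M] [OpensMeasurableSpace M] [IsLocallyFiniteMeasure μ]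

lemma IsSmoothHermitian.integrable_inner (hE : IsSmoothHermitian I E₀ E)
    {s t : SmoothSections I E₀ E} {K : Set M} (hK : IsCompact K) (hs : ∀ x ∉ K, s.1 x = 0) :
    Integrable (fun x => inner ℂ (s.1 x) (t.1 x)) μ :=
  (hE s t).continuous.integrable_of_hasCompactSupport
    (HasCompactSupport.intro hK fun x hx => by rw [hs x hx, inner_zero_left])

lemma IsFormalAdjoint.integral_inner_commutatorAt_add (hE : IsSmoothHermitian I E₀ E)
    (hF : IsSmoothHermitian I F₀ F) (hD : IsLocal D) (h : IsFormalAdjoint μ D Ddag)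
    (f : C^∞⟮I, M; ℝ⟯) {w : SmoothSections I E₀ E} (hw : IsCC w) (v : SmoothSections I F₀ F) :
    ∫ x, (inner ℂ (commutatorAt D f w x) (v.1 x) + inner ℂ (w.1 x) (commutatorAt Ddag f v x)) ∂μ =
      0 := by
  obtain ⟨K, hK, -, hwK⟩ := id hw
  have hfwK : ∀ x ∉ K, (mulFun f w).1 x = 0 := fun x hx => by
    rw [mulFun_apply, hwK x hx, smul_zero]
  have hpoint (x : M) : inner ℂ (commutatorAt D f w x) (v.1 x) +
      inner ℂ (w.1 x) (commutatorAt Ddag f v x) =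
      (inner ℂ ((D (mulFun f w)).1 x) (v.1 x) - inner ℂ ((D w).1 x) ((mulFun f v).1 x)) +
      (inner ℂ (w.1 x) ((Ddag (mulFun f v)).1 x) -
        inner ℂ ((mulFun f w).1 x) ((Ddag v).1 x)) := by
    simp only [commutatorAt, inner_sub_left, inner_sub_right, mulFun_apply f,
      inner_smul_left_eq_smul, inner_smul_right_eq_smul]
  have hDfw : Integrable (fun x => inner ℂ ((D (mulFun f w)).1 x) (v.1 x)) μ :=
    hF.integrable_inner hK (hD.eq_zero_of_notMem hK.isClosed hfwK)
  have hDw : Integrable (fun x => inner ℂ ((D w).1 x) ((mulFun f v).1 x)) μ :=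
    hF.integrable_inner hK (hD.eq_zero_of_notMem hK.isClosed hwK)
  have hwD : Integrable (fun x => inner ℂ (w.1 x) ((Ddag (mulFun f v)).1 x)) μ :=
    hE.integrable_inner hK hwK
  have hfwD : Integrable (fun x => inner ℂ ((mulFun f w).1 x) ((Ddag v).1 x)) μ :=
    hE.integrable_inner hK hfwK
  simp_rw [hpoint]
  calc _ = (∫ x, inner ℂ ((D (mulFun f w)).1 x) (v.1 x) ∂μ -
          ∫ x, inner ℂ ((D w).1 x) ((mulFun f v).1 x) ∂μ) +
        (∫ x, inner ℂ (w.1 x) ((Ddag (mulFun f v)).1 x) ∂μ -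
          ∫ x, inner ℂ ((mulFun f w).1 x) ((Ddag v).1 x) ∂μ) := by
        rw [← integral_sub hDfw hDw, ← integral_sub hwD hfwD]
        exact integral_add (hDfw.sub hDw) (hwD.sub hfwD)
    _ = 0 := by
        rw [h _ v (hw.mulFun f), h w _ hw]
        ring

end Integrals

variable [BorelSpace M] [T2Space M] [IsManifold I ∞ M] [SigmaCompactSpace M]

lemma IsFormalAdjoint.isLocal (hμ : IsSmoothMeasure I μ) (hE : IsSmoothHermitian I E₀ E)
    (hD : IsLocal D) (h : IsFormalAdjoint μ D Ddag) : IsLocal Ddag := by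
  intro v x hv
  obtain ⟨U, hUv, hU, hxU⟩ := eventually_nhds_iff.1 hv
  refine inner_self_eq_zero.1 (hμ.eqOn_zero_of_integral_smul_eq_zero
    (hE (Ddag v) (Ddag v)).continuous hU (fun b hb hbU => ?_) hxU)
  set w := mulFun b (Ddag v)
  have hzero (y : M) : inner ℂ ((D w).1 y) (v.1 y) = 0 := by
    by_cases hy : y ∈ tsupport b
    · rw [hUv y (hbU hy).1, inner_zero_right]
    · rw [hD.eq_zero_of_notMem (isClosed_tsupport b)
        (fun _ => mulFun_eq_zero_of_notMem (Ddag v)) y hy, inner_zero_left]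
  calc ∫ y, b y • inner ℂ ((Ddag v).1 y) ((Ddag v).1 y) ∂μ
      = ∫ y, inner ℂ (w.1 y) ((Ddag v).1 y) ∂μ := by
        simp only [w, mulFun_apply, inner_smul_left_eq_smul]
    _ = ∫ y, inner ℂ ((D w).1 y) (v.1 y) ∂μ :=
        (h w v (isCC_mulFun hb (hbU.trans inter_subset_right) _)).symm
    _ = 0 := by simp only [hzero, integral_zero]

/-- Smooth functions with compact support in the interior localise the integrated identity; the
boundary is reached by density of the interior. -/
lemma IsFormalAdjoint.inner_commutatorAt_add (hμ : IsSmoothMeasure I μ)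
    (hE : IsSmoothHermitian I E₀ E) (hF : IsSmoothHermitian I F₀ F)
    (hD : IsFirstOrder D) (h : IsFormalAdjoint μ D Ddag) (f : C^∞⟮I, M; ℝ⟯)
    (u : SmoothSections I E₀ E) (v : SmoothSections I F₀ F) (x : M) :
    inner ℂ (commutatorAt D f u x) (v.1 x) + inner ℂ (u.1 x) (commutatorAt Ddag f v x) = 0 := by
  have := hμ.isLocallyFiniteMeasure
  have hcont : Continuous fun x => inner ℂ (commutatorAt D f u x) (v.1 x) +
      inner ℂ (u.1 x) (commutatorAt Ddag f v x) :=
    (hF (commutatorSection D f u) v).continuous.add (hE u (commutatorSection Ddag f v)).continuous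
  refine hμ.eqOn_zero_of_integral_smul_eq_zero hcont isOpen_univ (fun b hb hbM => ?_) (mem_univ x)
  rw [univ_inter] at hbM
  simpa only [hD.commutatorAt_mulFun, mulFun_apply, inner_smul_left_eq_smul, ← smul_add]
    using h.integral_inner_commutatorAt_add hE hF hD.isLocal f (isCC_mulFun hb hbM u) v

end Commutators

/-! ### Square integrable sections -/

section L2

variable {M : Type*} [MeasurableSpace M] {μ : Measure M}
  {E : M → Type*} [∀ x, NormedAddCommGroup (E x)]
  {F : M → Type*} [∀ x, NormedAddCommGroup (F x)]

lemma l2Norm_eq_eLpNorm (u : ∀ x, E x) : l2Norm μ u = eLpNorm (fun x => ‖u x‖) 2 μ := by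
  rw [eLpNorm_eq_lintegral_rpow_enorm_toReal two_ne_zero ENNReal.ofNat_ne_top]
  simp [l2Norm]

lemma l2Norm_mono_of_norm_le {u : ∀ x, E x} {g : M → ℝ} (h : ∀ x, ‖u x‖ ≤ g x) :
    l2Norm μ u ≤ eLpNorm g 2 μ := by
  rw [l2Norm_eq_eLpNorm]
  exact eLpNorm_mono_real fun x => by simpa using h x

lemma l2Norm_sub_le {u v : ∀ x, E x} (hu : AEStronglyMeasurable (fun x => ‖u x‖) μ)
    (hv : AEStronglyMeasurable (fun x => ‖v x‖) μ) :
    l2Norm μ (u - v) ≤ l2Norm μ u + l2Norm μ v := by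
  refine (l2Norm_mono_of_norm_le fun x => norm_sub_le (u x) (v x)).trans ?_
  rw [l2Norm_eq_eLpNorm, l2Norm_eq_eLpNorm]
  exact eLpNorm_add_le hu hv (by norm_num)

lemma l2Norm_map_le {u : ∀ x, E x} {B : ∀ x, E x → F x} {c : ℝ}
    (hB : ∀ x e, ‖B x e‖ ≤ c * ‖e‖) :
    l2Norm μ (fun x => B x (u x)) ≤ ENNReal.ofReal c * l2Norm μ u := by
  rw [l2Norm_eq_eLpNorm, l2Norm_eq_eLpNorm]
  exact eLpNorm_le_mul_eLpNorm_of_ae_le_mul (.of_forall fun x => by simpa using hB x (u x)) 2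

lemma tendsto_l2Norm_sub_smul [∀ x, NormedSpace ℝ (E x)] {u : ∀ x, E x}
    (hu : MemLp (fun x => ‖u x‖) 2 μ) {χ : ℕ → M → ℝ} (hχ : ∀ k, AEStronglyMeasurable (χ k) μ)
    (hχI : ∀ k x, χ k x ∈ Icc (0 : ℝ) 1) (hlim : ∀ x, Tendsto (χ · x) atTop (𝓝 1)) :
    Tendsto (fun k => l2Norm μ (u - fun x => χ k x • u x)) atTop (𝓝 0) := by
  have hnorm (k : ℕ) (x : M) : ‖(u - fun x => χ k x • u x) x‖ = (1 - χ k x) * ‖u x‖ := by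
    rw [← Real.norm_of_nonneg (sub_nonneg.2 (hχI k x).2), ← norm_smul, sub_smul, one_smul,
      Pi.sub_apply]
  have hsq : Tendsto (fun k => ∫⁻ x, ‖(u - fun x => χ k x • u x) x‖ₑ ^ 2 ∂μ) atTop
      (𝓝 (∫⁻ _, 0 ∂μ)) := by
    refine tendsto_lintegral_of_dominated_convergence' (fun x => ‖u x‖ₑ ^ 2) (fun k => ?_)
      (fun k => .of_forall fun x => ?_) ?_ (.of_forall fun x => ?_)
    · have : AEStronglyMeasurable (fun x => ‖(u - fun x => χ k x • u x) x‖) μ := by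
        simp only [hnorm]
        exact (aestronglyMeasurable_const.sub (hχ k)).mul hu.1
      simpa using this.enorm.pow_const 2
    · refine pow_le_pow_left' (enorm_le_iff_norm_le.2 ?_) 2
      rw [hnorm]
      exact mul_le_of_le_one_left (norm_nonneg _) (by linarith [(hχI k x).1])
    · have hfin : l2Norm μ u < ⊤ := (l2Norm_eq_eLpNorm u).trans_lt hu.2
      exact ((ENNReal.rpow_lt_top_iff_of_pos one_half_pos).1 hfin).ne
    · have := (((hlim x).smul_const (u x)).const_sub (u x)).enorm
      simpa using ENNReal.Tendsto.pow (n := 2) this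
  simpa [l2Norm] using hsq.ennrpow_const (1 / 2)

lemma tendsto_graphNorm_zero {q : ℕ → (∀ x, E x) × (∀ x, F x)}
    (h₁ : Tendsto (fun k => l2Norm μ (q k).1) atTop (𝓝 0))
    (h₂ : Tendsto (fun k => l2Norm μ (q k).2) atTop (𝓝 0)) :
    Tendsto (fun k => graphNorm μ (q k)) atTop (𝓝 0) := by
  simpa [graphNorm] using
    ((ENNReal.Tendsto.pow (n := 2) h₁).add (ENNReal.Tendsto.pow (n := 2) h₂)).ennrpow_const (1 / 2)

end L2

/-! ### Completeness from cutoff functions -/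

lemma norm_adjoint_apply_le {𝕜 V W : Type*} [RCLike 𝕜] [NormedAddCommGroup V]
    [InnerProductSpace 𝕜 V] [FiniteDimensional 𝕜 V] [NormedAddCommGroup W]
    [InnerProductSpace 𝕜 W] [FiniteDimensional 𝕜 W] {A : V →ₗ[𝕜] W} {c : ℝ} (hc : 0 ≤ c)
    (hA : ∀ v, ‖A v‖ ≤ c * ‖v‖) (w : W) : ‖LinearMap.adjoint A w‖ ≤ c * ‖w‖ := by
  have := FiniteDimensional.complete 𝕜 V
  have := FiniteDimensional.complete 𝕜 W
  have hnorm : ‖ContinuousLinearMap.adjoint A.toContinuousLinearMap‖ ≤ c := by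
    rw [LinearIsometryEquiv.norm_map]
    exact ContinuousLinearMap.opNorm_le_bound _ hc hA
  rw [LinearMap.adjoint_eq_toCLM_adjoint]
  exact ContinuousLinearMap.le_of_opNorm_le _ hnorm w

/-- A smooth function on `ℝ` with values in `[0, 1]`, equal to `1` on `[-1, 1]` and to `0` outside
`[-2, 2]`. -/
def cutoffBump : ContDiffBump (0 : ℝ) := ⟨1, 2, one_pos, one_lt_two⟩

lemma exists_forall_abs_deriv_cutoffBump_le : ∃ B, ∀ t, |deriv cutoffBump t| ≤ B := by
  have hcont := cutoffBump.contDiff.continuous_deriv (n := 1) le_rfl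
  exact hcont.bounded_above_of_compact_support cutoffBump.hasCompactSupport.deriv

section CutoffOf

variable {V H M : Type*} [NormedAddCommGroup V] [NormedSpace ℝ V] [TopologicalSpace H]
  {I : ModelWithCorners ℝ V H} [TopologicalSpace M] [ChartedSpace H M]

/-- Smooth functions with values in `[0, 1]` and with compact supports, which converge to `1`
pointwise. -/
structure IsCutoffSequence (χ : ℕ → C^∞⟮I, M; ℝ⟯) : Prop where
  mem_Icc : ∀ k x, χ k x ∈ Icc (0 : ℝ) 1
  hasCompactSupport : ∀ k, HasCompactSupport (χ k)
  tendsto_one : ∀ x, Tendsto (χ · x) atTop (𝓝 1)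

lemma mvfderiv_real_comp {g : ℝ → ℝ} {f : M → ℝ} {x : M} (hg : DifferentiableAt ℝ g (f x))
    (hf : MDifferentiableAt I 𝓘(ℝ, ℝ) f x) :
    mvfderiv I (g ∘ f) x = deriv g (f x) • mvfderiv I f x := by
  rw [mvfderiv_comp x hg.mdifferentiableAt hf]
  ext v
  have hgv : mvfderiv 𝓘(ℝ, ℝ) g (f x) = fderiv ℝ g (f x) := mfderiv_eq_fderiv
  rw [hgv]
  exact (fderiv_eq_smul_deriv _).trans (mul_comm _ _)

/-- The cutoff function `θ (ρ / (k + 1))` of a real function `ρ`, where `θ` is `cutoffBump`. -/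
def cutoff (ρ : C^∞⟮I, M; ℝ⟯) (k : ℕ) : C^∞⟮I, M; ℝ⟯ :=
  ⟨fun x => cutoffBump ((k + 1 : ℝ)⁻¹ * ρ x),
    (cutoffBump.contDiff.comp (contDiff_const.mul contDiff_id)).contMDiff.comp ρ.contMDiff⟩

lemma mvfderiv_cutoff (ρ : C^∞⟮I, M; ℝ⟯) (k : ℕ) (x : M) :
    mvfderiv I (cutoff ρ k) x =
      ((k + 1 : ℝ)⁻¹ * deriv cutoffBump ((k + 1 : ℝ)⁻¹ * ρ x)) • mvfderiv I ρ x := by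
  have hθ : Differentiable ℝ cutoffBump := cutoffBump.contDiff.differentiable one_ne_zero
  have h := mvfderiv_real_comp (I := I) (g := fun r => cutoffBump ((k + 1 : ℝ)⁻¹ * r)) (f := ρ)
    (x := x) (by fun_prop) (ρ.contMDiff.mdifferentiableAt (by simp))
  rw [deriv_comp_mul_left, smul_eq_mul] at h
  exact h

lemma isCutoffSequence_cutoff [T2Space M] {ρ : C^∞⟮I, M; ℝ⟯} (hρ : Tendsto ρ (cocompact M) atTop) :
    IsCutoffSequence (cutoff ρ) where
  mem_Icc k x := ⟨cutoffBump.nonneg, cutoffBump.le_one⟩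
  hasCompactSupport k := by
    obtain ⟨K, hK, hρK⟩ := mem_cocompact.1 (hρ.eventually_ge_atTop (2 * (k + 1)))
    refine HasCompactSupport.intro hK fun x hx => cutoffBump.zero_of_le_dist ?_
    have : (2 : ℝ) * (k + 1) ≤ ρ x := hρK hx
    rw [Real.dist_0_eq_abs, inv_mul_eq_div]
    exact le_trans ((le_div_iff₀ (by positivity)).2 this) (le_abs_self _)
  tendsto_one x := by
    have : Tendsto (fun k : ℕ => (k + 1 : ℝ)⁻¹ * ρ x) atTop (𝓝 0) := by
      simpa using tendsto_inv_atTop_zero.comp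
        (tendsto_atTop_add_const_right _ 1 tendsto_natCast_atTop_atTop) |>.mul_const (ρ x)
    have := (cutoffBump.continuous.tendsto 0).comp this
    rwa [cutoffBump.one_of_mem_closedBall (Metric.mem_closedBall_self zero_le_one)] at this

end CutoffOf

section Completeness

variable {n : ℕ} {H : Type*} [TopologicalSpace H]
  {I : ModelWithCorners ℝ (EuclideanSpace ℝ (Fin n)) H}
  {M : Type*} [TopologicalSpace M] [ChartedSpace H M]
  {E₀ : Type*} [NormedAddCommGroup E₀] [NormedSpace ℂ E₀]
  {E : M → Type*} [TopologicalSpace (TotalSpace E₀ E)]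
  [∀ x, NormedAddCommGroup (E x)] [∀ x, InnerProductSpace ℂ (E x)]
  [FiberBundle E₀ E] [VectorBundle ℂ E₀ E] [VectorBundle ℝ E₀ E]
  {F₀ : Type*} [NormedAddCommGroup F₀] [NormedSpace ℂ F₀]
  {F : M → Type*} [TopologicalSpace (TotalSpace F₀ F)]
  [∀ x, NormedAddCommGroup (F x)] [∀ x, InnerProductSpace ℂ (F x)]
  [FiberBundle F₀ F] [VectorBundle ℂ F₀ F] [VectorBundle ℝ F₀ F]

lemma symbolMap_cutoff [T2Space M] [IsManifold I ∞ M] [ContMDiffVectorBundle ∞ E₀ E I]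
    {D : SmoothSections I E₀ E →ₗ[ℂ] SmoothSections I F₀ F} (hD : IsFirstOrder D)
    (ρ : C^∞⟮I, M; ℝ⟯) (k : ℕ) (x : M) (e : E x) :
    symbolMap hD (cutoff ρ k) x e =
      ((k + 1 : ℝ)⁻¹ * deriv cutoffBump ((k + 1 : ℝ)⁻¹ * ρ x)) • symbolMap hD ρ x e := by
  change principalSymbol D x (mvfderiv I (cutoff ρ k) x) e = _
  rw [mvfderiv_cutoff]
  exact hD.principalSymbol_smul x _ _ e

variable [MeasurableSpace M] {μ : Measure M}

/-- `B : E → F` is a smooth bundle homomorphism, of norm at most `c` on every fibre, which is minus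
the adjoint of the commutator `[T, f]`. Formally `B = [T*, f]`, so `T* (f u) = f T* u + B u`. -/
structure IsAdjointCommutator (T : SmoothSections I F₀ F →ₗ[ℂ] SmoothSections I E₀ E)
    (f : C^∞⟮I, M; ℝ⟯) (B : ∀ x, E x →ₗ[ℂ] F x) (c : ℝ) : Prop where
  isSmoothHom : IsSmoothHom I E₀ F₀ B
  norm_le : ∀ x e, ‖B x e‖ ≤ c * ‖e‖
  inner_add : ∀ (φ : SmoothSections I F₀ F) (x : M) (e : E x),
    inner ℂ (commutatorAt T f φ x) e + inner ℂ (φ.1 x) (B x e) = 0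

section FormalAdjoint

variable [BorelSpace M] [T2Space M] [IsManifold I ∞ M] [SigmaCompactSpace M]
  [ContMDiffVectorBundle ∞ E₀ E I]
  {D : SmoothSections I E₀ E →ₗ[ℂ] SmoothSections I F₀ F}
  {Ddag : SmoothSections I F₀ F →ₗ[ℂ] SmoothSections I E₀ E} {f : C^∞⟮I, M; ℝ⟯} {c : ℝ}

lemma IsFormalAdjoint.isAdjointCommutator (hμ : IsSmoothMeasure I μ)
    (hE : IsSmoothHermitian I E₀ E) (hF : IsSmoothHermitian I F₀ F) (hD : IsFirstOrder D)
    (h : IsFormalAdjoint μ D Ddag) (hc : ∀ x e, ‖symbolMap hD f x e‖ ≤ c * ‖e‖) :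
    IsAdjointCommutator Ddag f (symbolMap hD f) c where
  isSmoothHom s := by
    convert (commutatorSection D f s).2 using 2
    exact symbolMap_apply hD f s _
  norm_le := hc
  inner_add φ x e := by
    obtain ⟨u, rfl⟩ := exists_section_eq (I := I) (E₀ := E₀) x e
    rw [symbolMap_apply, ← inner_conj_symm, ← inner_conj_symm (φ.1 x), ← map_add, add_comm,
      h.inner_commutatorAt_add hμ hE hF hD, map_zero]

lemma IsFormalAdjoint.isAdjointCommutator_adjoint [∀ x, FiniteDimensional ℂ (E x)]
    [∀ x, FiniteDimensional ℂ (F x)] (hμ : IsSmoothMeasure I μ)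
    (hE : IsSmoothHermitian I E₀ E) (hF : IsSmoothHermitian I F₀ F) (hD : IsFirstOrder D)
    (h : IsFormalAdjoint μ D Ddag) (hc₀ : 0 ≤ c) (hc : ∀ x e, ‖symbolMap hD f x e‖ ≤ c * ‖e‖) :
    IsAdjointCommutator D f (fun x => -LinearMap.adjoint (symbolMap hD f x)) c where
  isSmoothHom s := by
    convert (commutatorSection Ddag f s).2 using 3 with x
    refine ext_inner_left ℂ fun v => ?_
    obtain ⟨u, rfl⟩ := exists_section_eq (I := I) (E₀ := E₀) x v
    rw [LinearMap.neg_apply, inner_neg_right, LinearMap.adjoint_inner_right, symbolMap_apply]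
    exact neg_eq_of_add_eq_zero_right (h.inner_commutatorAt_add hμ hE hF hD f u s x)
  norm_le x e := by
    rw [LinearMap.neg_apply, norm_neg]
    exact norm_adjoint_apply_le hc₀ (hc x) e
  inner_add φ x e := by
    rw [LinearMap.neg_apply, inner_neg_right, LinearMap.adjoint_inner_right, symbolMap_apply,
      add_neg_cancel]

end FormalAdjoint

variable [BorelSpace M] [SecondCountableTopology M] [T2Space M] [IsManifold I ∞ M]
  [ContMDiffVectorBundle ∞ E₀ E I] [FiniteDimensional ℂ E₀]

lemma MemL2.memLp_norm (hE : IsSmoothHermitian I E₀ E) {u : ∀ x, E x} (hu : MemL2 E₀ μ u) :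
    MemLp (fun x => ‖u x‖) 2 μ :=
  ⟨hu.1.norm hE, (l2Norm_eq_eLpNorm u).symm.trans_lt hu.2⟩

lemma MemL2.add (hE : IsSmoothHermitian I E₀ E) {u v : ∀ x, E x} (hu : MemL2 E₀ μ u)
    (hv : MemL2 E₀ μ v) : MemL2 E₀ μ (u + v) :=
  ⟨hu.1.add hv.1, (l2Norm_mono_of_norm_le fun x => norm_add_le (u x) (v x)).trans_lt
    ((hu.memLp_norm hE).add (hv.memLp_norm hE)).2⟩

lemma MemL2.map [ContMDiffVectorBundle ∞ F₀ F I] {B : ∀ x, E x →ₗ[ℂ] F x}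
    (hB : IsSmoothHom I E₀ F₀ B) {c : ℝ} (hc : ∀ x e, ‖B x e‖ ≤ c * ‖e‖) {u : ∀ x, E x}
    (hu : MemL2 E₀ μ u) : MemL2 F₀ μ (fun x => B x (u x)) :=
  ⟨hu.1.map hB, (l2Norm_map_le (B := fun x => B x) hc).trans_lt
    (ENNReal.mul_lt_top ENNReal.ofReal_lt_top hu.2)⟩

lemma MemL2.smul (f : C^∞⟮I, M; ℝ⟯) {c : ℝ} (hf : ∀ x, |f x| ≤ c) {u : ∀ x, E x}
    (hu : MemL2 E₀ μ u) : MemL2 E₀ μ (fun x => f x • u x) := by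
  have hB : IsSmoothHom I E₀ E₀ (E := E) fun x => ((f x : ℝ) : ℂ) • LinearMap.id := fun s => by
    simpa [mulFun] using (mulFun f s).2
  have hc (x : M) (e : E x) : ‖(((f x : ℝ) : ℂ) • LinearMap.id : E x →ₗ[ℂ] E x) e‖ ≤ c * ‖e‖ := by
    simpa [norm_smul] using mul_le_mul_of_nonneg_right (hf x) (norm_nonneg e)
  simpa using hu.map hB hc

lemma MemL2.integrable_inner [IsLocallyFiniteMeasure μ] (hE : IsSmoothHermitian I E₀ E)
    {u : ∀ x, E x} (hu : MemL2 E₀ μ u) {s : SmoothSections I E₀ E} {K : Set M} (hK : IsCompact K)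
    (hs : ∀ x ∉ K, s.1 x = 0) : Integrable (fun x => inner ℂ (s.1 x) (u x)) μ := by
  have hsL : MemLp (fun x => ‖s.1 x‖) 2 μ := (hE.continuous_norm s).memLp_of_hasCompactSupport
    (HasCompactSupport.intro hK fun x hx => by rw [hs x hx, norm_zero])
  exact (hsL.integrable_mul (hu.memLp_norm hE)).mono' (hu.1.inner_smooth hE s)
    (.of_forall fun x => norm_inner_le_norm _ _)

variable [ContMDiffVectorBundle ∞ F₀ F I] [FiniteDimensional ℂ F₀]

lemma IsAdjointCommutator.l2Norm_sub_le (hF : IsSmoothHermitian I F₀ F)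
    {T : SmoothSections I F₀ F →ₗ[ℂ] SmoothSections I E₀ E} {χ : C^∞⟮I, M; ℝ⟯}
    (hχ : ∀ x, χ x ∈ Icc (0 : ℝ) 1) {B : ∀ x, E x →ₗ[ℂ] F x} {c : ℝ}
    (hB : IsAdjointCommutator T χ B c) {u : ∀ x, E x} (hu : MemL2 E₀ μ u) {w : ∀ x, F x}
    (hw : MemL2 F₀ μ w) :
    l2Norm μ (w - ((fun x => χ x • w x) + fun x => B x (u x))) ≤
      l2Norm μ (w - fun x => χ x • w x) + ENNReal.ofReal c * l2Norm μ u := by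
  have hsub : w - (fun x => χ x • w x) = fun x => (1 - χ) x • w x := by
    ext x
    simp [sub_smul]
  have hwL : MemL2 F₀ μ (w - fun x => χ x • w x) := hsub ▸ hw.smul (1 - χ) (c := 1) fun x =>
    abs_le.2 ⟨by simpa using (hχ x).2.trans (by norm_num), by simpa using (hχ x).1⟩
  have hBL : MemL2 F₀ μ (fun x => B x (u x)) := hu.map hB.isSmoothHom hB.norm_le
  rw [← sub_sub]
  exact (FirstOrderCompleteness.l2Norm_sub_le (hwL.memLp_norm hF).1 (hBL.memLp_norm hF).1).trans
    (add_le_add_right (l2Norm_map_le (B := fun x => B x) hB.norm_le) _)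

section CutoffSequence

variable [IsLocallyFiniteMeasure μ] {T : SmoothSections I F₀ F →ₗ[ℂ] SmoothSections I E₀ E}

lemma IsAdjointCommutator.smul_mem_adjointGraph (hE : IsSmoothHermitian I E₀ E)
    (hF : IsSmoothHermitian I F₀ F) (hT : IsLocal T) {f : C^∞⟮I, M; ℝ⟯} {c₀ : ℝ}
    (hf : ∀ x, |f x| ≤ c₀) {B : ∀ x, E x →ₗ[ℂ] F x} {c : ℝ} (hB : IsAdjointCommutator T f B c)
    {u : ∀ x, E x} {w : ∀ x, F x} (h : (u, w) ∈ adjointGraph μ T) :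
    ((fun x => f x • u x), (fun x => f x • w x) + fun x => B x (u x)) ∈ adjointGraph μ T := by
  obtain ⟨hu, hw, h⟩ := h
  have hBu := hu.map hB.isSmoothHom hB.norm_le
  refine ⟨hu.smul f hf, (hw.smul f hf).add hF hBu, fun φ hφ => ?_⟩
  obtain ⟨K, hK, -, hφK⟩ := id hφ
  have hfφK : ∀ x ∉ K, (mulFun f φ).1 x = 0 := fun x hx => by
    rw [mulFun_apply, hφK x hx, smul_zero]
  have hleft (x : M) : inner ℂ ((T φ).1 x) (f x • u x) =
      inner ℂ ((T (mulFun f φ)).1 x) (u x) + inner ℂ (φ.1 x) (B x (u x)) := by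
    have := hB.inner_add φ x (u x)
    rw [commutatorAt, inner_sub_left, inner_smul_left_eq_smul] at this
    rw [inner_smul_right_eq_smul]
    linear_combination -this
  have hright (x : M) : inner ℂ (φ.1 x) (f x • w x + B x (u x)) =
      inner ℂ ((mulFun f φ).1 x) (w x) + inner ℂ (φ.1 x) (B x (u x)) := by
    rw [inner_add_right, inner_smul_right_eq_smul, mulFun_apply, inner_smul_left_eq_smul]
  have hφB := hBu.integrable_inner hF hK hφK
  calc ∫ x, inner ℂ ((T φ).1 x) (f x • u x) ∂μ
      = ∫ x, inner ℂ ((T (mulFun f φ)).1 x) (u x) ∂μ + ∫ x, inner ℂ (φ.1 x) (B x (u x)) ∂μ := by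
        simp_rw [hleft]
        exact integral_add
          (hu.integrable_inner hE hK (hT.eq_zero_of_notMem hK.isClosed hfφK)) hφB
    _ = ∫ x, inner ℂ ((mulFun f φ).1 x) (w x) ∂μ + ∫ x, inner ℂ (φ.1 x) (B x (u x)) ∂μ := by
        rw [h _ (hφ.mulFun f)]
    _ = ∫ x, inner ℂ (φ.1 x) (f x • w x + B x (u x)) ∂μ := by
        simp_rw [hright]
        exact (integral_add (hw.integrable_inner hF hK hfφK) hφB).symm

lemma isComplete_adjointGraph (hE : IsSmoothHermitian I E₀ E) (hF : IsSmoothHermitian I F₀ F)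
    (hT : IsLocal T) {χ : ℕ → C^∞⟮I, M; ℝ⟯} (hχ : IsCutoffSequence χ)
    {B : ℕ → ∀ x, E x →ₗ[ℂ] F x} {c : ℕ → ℝ} (hB : ∀ k, IsAdjointCommutator T (χ k) (B k) (c k))
    (hc : Tendsto c atTop (𝓝 0)) :
    IsComplete μ (adjointGraph μ T) := by
  rintro ⟨u, w⟩ hq ε hε
  obtain ⟨hu, hw, -⟩ := id hq
  dsimp only at hu hw
  let q (k : ℕ) : (∀ x, E x) × (∀ x, F x) :=
    (fun x => χ k x • u x, (fun x => χ k x • w x) + fun x => B k x (u x))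
  have hχm (k : ℕ) : AEStronglyMeasurable (χ k) μ :=
    (χ k).contMDiff.continuous.aestronglyMeasurable
  have hfst : Tendsto (fun k => l2Norm μ (u - (q k).1)) atTop (𝓝 0) :=
    tendsto_l2Norm_sub_smul (hu.memLp_norm hE) hχm hχ.mem_Icc hχ.tendsto_one
  have hsnd : Tendsto (fun k => l2Norm μ (w - (q k).2)) atTop (𝓝 0) := by
    have hw0 := tendsto_l2Norm_sub_smul (hw.memLp_norm hF) hχm hχ.mem_Icc hχ.tendsto_one
    have hBu : Tendsto (fun k => ENNReal.ofReal (c k) * l2Norm μ u) atTop (𝓝 0) := by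
      simpa using ENNReal.Tendsto.mul_const (ENNReal.tendsto_ofReal hc) (.inr hu.2.ne)
    refine tendsto_of_tendsto_of_tendsto_of_le_of_le tendsto_const_nhds
      (by simpa using hw0.add hBu) (fun k => zero_le) fun k => ?_
    exact (hB k).l2Norm_sub_le hF (hχ.mem_Icc k) hu hw
  obtain ⟨k, hk⟩ := ((tendsto_graphNorm_zero (q := fun k => (u, w) - q k) hfst hsnd).eventually
    (gt_mem_nhds (ENNReal.ofReal_pos.2 hε))).exists
  refine ⟨q k, (hB k).smul_mem_adjointGraph hE hF hT (c₀ := 1) (fun x => ?_) hq,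
    ⟨tsupport (χ k), hχ.hasCompactSupport k, fun x hx => ?_⟩, hk⟩
  · exact abs_le.2 ⟨by linarith [(hχ.mem_Icc k x).1], (hχ.mem_Icc k x).2⟩
  · simp [q, image_eq_zero_of_notMem_tsupport hx]

end CutoffSequence

theorem isComplete_of_isCutoffSequence (hμ : IsSmoothMeasure I μ) (hE : IsSmoothHermitian I E₀ E)
    (hF : IsSmoothHermitian I F₀ F) {D : SmoothSections I E₀ E →ₗ[ℂ] SmoothSections I F₀ F}
    (hD : IsFirstOrder D) {Ddag : SmoothSections I F₀ F →ₗ[ℂ] SmoothSections I E₀ E}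
    (hDdag : IsFormalAdjoint μ D Ddag) {χ : ℕ → C^∞⟮I, M; ℝ⟯} (hχ : IsCutoffSequence χ)
    {c : ℕ → ℝ} (hc₀ : ∀ k, 0 ≤ c k) (hc : ∀ k x e, ‖symbolMap hD (χ k) x e‖ ≤ c k * ‖e‖)
    (hlim : Tendsto c atTop (𝓝 0)) :
    IsComplete μ (maxGraph μ Ddag) ∧ IsComplete μ (maxGraph μ D) := by
  have : LocallyCompactSpace H := I.locallyCompactSpace
  have : LocallyCompactSpace M := ChartedSpace.locallyCompactSpace H M
  have := hμ.isLocallyFiniteMeasure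
  have (x : M) : FiniteDimensional ℂ (E x) := finiteDimensional_fiber E₀ x
  have (x : M) : FiniteDimensional ℂ (F x) := finiteDimensional_fiber F₀ x
  exact ⟨isComplete_adjointGraph hE hF (hDdag.isLocal hμ hE hD.isLocal) hχ
      (fun k => hDdag.isAdjointCommutator hμ hE hF hD (hc k)) hlim,
    isComplete_adjointGraph hF hE hD.isLocal hχ
      (fun k => hDdag.isAdjointCommutator_adjoint hμ hE hF hD (hc₀ k) (hc k)) hlim⟩

theorem isComplete_of_exhaustion (hμ : IsSmoothMeasure I μ)
    (hE : IsSmoothHermitian I E₀ E) (hF : IsSmoothHermitian I F₀ F)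
    {D : SmoothSections I E₀ E →ₗ[ℂ] SmoothSections I F₀ F}
    (hD : IsFirstOrder D) {Ddag : SmoothSections I F₀ F →ₗ[ℂ] SmoothSections I E₀ E}
    (hDdag : IsFormalAdjoint μ D Ddag) {ρ : C^∞⟮I, M; ℝ⟯}
    (hρ : Tendsto ρ (cocompact M) atTop) {c : ℝ} (hc₀ : 0 ≤ c)
    (hc : ∀ x e, ‖symbolMap hD ρ x e‖ ≤ c * ‖e‖) :
    IsComplete μ (maxGraph μ Ddag) ∧ IsComplete μ (maxGraph μ D) := by
  obtain ⟨B, hB⟩ := exists_forall_abs_deriv_cutoffBump_le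
  have hB₀ : 0 ≤ B := (abs_nonneg _).trans (hB 0)
  refine isComplete_of_isCutoffSequence hμ hE hF hD hDdag (isCutoffSequence_cutoff hρ)
    (c := fun k : ℕ => B / (k + 1) * c) (fun k => by positivity) (fun k x e => ?_) ?_
  · rw [symbolMap_cutoff, norm_smul, norm_mul, Real.norm_of_nonneg (by positivity),
      inv_mul_eq_div, mul_assoc]
    exact mul_le_mul (by gcongr; exact hB _) (hc x e) (norm_nonneg _) (by positivity)
  · simpa using (tendsto_const_nhds.div_atTop
      (tendsto_atTop_add_const_right _ 1 tendsto_natCast_atTop_atTop)).mul_const c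

end Completeness

/-! ### Smooth approximation of Lipschitz functions on normed spaces -/

section Smoothing

open scoped NNReal Convolution

variable {V W : Type*} [NormedAddCommGroup V] [NormedSpace ℝ V] [FiniteDimensional ℝ V]
  [NormedAddCommGroup W] [NormedSpace ℝ W] {L : ℝ≥0}

lemma lipschitzWith_convolution_normed [MeasurableSpace V] [BorelSpace V] (μ : Measure V)
    [μ.IsAddHaarMeasure] (φ : ContDiffBump (0 : V)) {g : V → ℝ} (hg : LipschitzWith L g) :
    LipschitzWith L (φ.normed μ ⋆[ContinuousLinearMap.lsmul ℝ ℝ, μ] g) := by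
  have hconv : ConvolutionExists (φ.normed μ) g (ContinuousLinearMap.lsmul ℝ ℝ) μ :=
    φ.hasCompactSupport_normed.convolutionExists_left _ φ.continuous_normed
      hg.continuous.locallyIntegrable
  refine LipschitzWith.of_dist_le_mul fun x y => ?_
  rw [dist_eq_norm, convolution_def, convolution_def,
    ← integral_sub (hconv x).integrable (hconv y).integrable]
  calc ‖∫ t, (ContinuousLinearMap.lsmul ℝ ℝ (φ.normed μ t) (g (x - t)) -
          ContinuousLinearMap.lsmul ℝ ℝ (φ.normed μ t) (g (y - t))) ∂μ‖
      ≤ ∫ t, φ.normed μ t * (L * dist x y) ∂μ := by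
        refine norm_integral_le_of_norm_le (φ.integrable_normed.mul_const _)
          (Eventually.of_forall fun t => ?_)
        have hgt : dist (g (x - t)) (g (y - t)) ≤ L * dist x y := by
          simpa using hg.dist_le_mul (x - t) (y - t)
        rw [← map_sub, ContinuousLinearMap.lsmul_apply, norm_smul,
          Real.norm_of_nonneg (φ.nonneg_normed t), ← dist_eq_norm]
        exact mul_le_mul_of_nonneg_left hgt (φ.nonneg_normed t)
    _ = L * dist x y := by rw [integral_mul_const, φ.integral_normed, one_mul]

lemma exists_contDiff_lipschitzWith_approx {g : V → ℝ} (hg : LipschitzWith L g) {ε : ℝ}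
    (hε : 0 < ε) :
    ∃ f : V → ℝ, ContDiff ℝ ∞ f ∧ LipschitzWith L f ∧ ∀ x, |f x - g x| ≤ ε := by
  borelize V
  let μ : Measure V := Measure.addHaar
  set δ : ℝ := ε / (L + 1)
  have hδ : 0 < δ := by positivity
  let φ : ContDiffBump (0 : V) := ⟨δ / 2, δ, half_pos hδ, half_lt_self hδ⟩
  refine ⟨φ.normed μ ⋆[ContinuousLinearMap.lsmul ℝ ℝ, μ] g,
    φ.hasCompactSupport_normed.contDiff_convolution_left _ φ.contDiff_normed
      hg.continuous.locallyIntegrable, lipschitzWith_convolution_normed μ φ hg, fun x => ?_⟩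
  rw [← Real.dist_eq]
  refine φ.dist_normed_convolution_le hg.continuous.aestronglyMeasurable fun y hy => ?_
  calc dist (g y) (g x) ≤ L * dist y x := hg.dist_le_mul y x
    _ ≤ (L + 1) * δ := by
        gcongr
        · exact le_add_of_nonneg_right zero_le_one
        · exact (Metric.mem_ball.1 hy).le
    _ = ε := mul_div_cancel₀ _ (by positivity)

/- The pullback of the norm of `V` under `A` stands for an inner product on `W`, with respect to
which `g` is Lipschitz and the differential of `f` is measured. -/
lemma exists_contDiff_norm_fderiv_apply_le (A : W →L[ℝ] V) {g : W → ℝ} {s : Set W}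
    (hg : ∀ y ∈ s, ∀ z ∈ s, |g y - g z| ≤ L * ‖A (y - z)‖) {ε : ℝ} (hε : 0 < ε) :
    ∃ f : W → ℝ, ContDiff ℝ ∞ f ∧ (∀ y v, ‖fderiv ℝ f y v‖ ≤ L * ‖A v‖) ∧
      ∀ y ∈ s, |f y - g y| ≤ ε := by
  let B : V → W := Function.invFunOn A s
  have hB : ∀ y ∈ s, B (A y) ∈ s ∧ A (B (A y)) = A y := fun y hy =>
    Function.invFunOn_pos ⟨y, hy, rfl⟩
  have hgB : ∀ y ∈ s, g (B (A y)) = g y := fun y hy => by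
    have hle := hg _ (hB y hy).1 y hy
    rw [map_sub, (hB y hy).2, sub_self, norm_zero, mul_zero] at hle
    exact sub_eq_zero.1 (abs_nonpos_iff.1 hle)
  have hlip : LipschitzOnWith L (g ∘ B) (A '' s) := by
    refine LipschitzOnWith.of_dist_le_mul ?_
    rintro _ ⟨y, hy, rfl⟩ _ ⟨z, hz, rfl⟩
    simpa [hgB y hy, hgB z hz, Real.dist_eq, dist_eq_norm] using hg y hy z hz
  obtain ⟨G, hG, hGs⟩ := hlip.extend_real
  obtain ⟨f, hf, hfL, hfG⟩ := exists_contDiff_lipschitzWith_approx hG hε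
  refine ⟨f ∘ A, hf.comp A.contDiff, fun y v => ?_, fun y hy => ?_⟩
  · have hfA : HasFDerivAt (f ∘ A) ((fderiv ℝ f (A y)) ∘L A) y :=
      ((hf.differentiable (by simp)) (A y)).hasFDerivAt.comp y A.hasFDerivAt
    rw [hfA.fderiv]
    exact ContinuousLinearMap.le_of_opNorm_le _ (norm_fderiv_le_of_lipschitz ℝ hfL) _
  · have hGy : G (A y) = g y := (hGs (mem_image_of_mem A hy)).symm.trans (hgB y hy)
    exact hGy ▸ hfG (A y)

end Smoothing

/-! ### Riemannian metrics in charts -/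

section ChartEstimates

variable {V H M : Type*} [NormedAddCommGroup V] [NormedSpace ℝ V] [TopologicalSpace H]
  {I : ModelWithCorners ℝ V H}

section TopologicalSpace

variable [TopologicalSpace M] [ChartedSpace H M] [IsManifold I ∞ M]

/-- The inverse of the trivialization of the tangent bundle around `x₀`, at the point `x₀`: the
pullback of the norm of `T_{x₀} M` under it is the Riemannian metric at `x₀` read in the chart. -/
def chartTangentMap (I : ModelWithCorners ℝ V H) [IsManifold I ∞ M] (x₀ : M) :
    V →L[ℝ] TangentSpace I x₀ :=
  (trivializationAt V (TangentSpace I) x₀).symmL ℝ x₀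

lemma continuousLinearMapAt_chartTangentMap (x₀ : M) (v : V) :
    (trivializationAt V (TangentSpace I) x₀).continuousLinearMapAt ℝ x₀
      (chartTangentMap I x₀ v) = v :=
  Trivialization.continuousLinearMapAt_symmL _ (FiberBundle.mem_baseSet_trivializationAt' x₀) v

lemma symmL_extChartAt_symm {x₀ : M} {y : V} (hy : y ∈ (extChartAt I x₀).target) (v : V) :
    (trivializationAt V (TangentSpace I) x₀).symmL ℝ ((extChartAt I x₀).symm y) v =
      mfderivWithin 𝓘(ℝ, V) I (extChartAt I x₀).symm (range I) y v := by
  obtain ⟨x, hx, rfl⟩ : ∃ x ∈ (extChartAt I x₀).source, extChartAt I x₀ x = y :=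
    ⟨_, (extChartAt I x₀).map_target hy, (extChartAt I x₀).right_inv hy⟩
  rw [TangentBundle.symmL_trivializationAt, (extChartAt I x₀).left_inv hx]
  · rfl
  · rwa [(extChartAt I x₀).left_inv hx, ← extChartAt_source (I := I)]

variable [RiemannianBundle (fun x : M => TangentSpace I x)]
  [IsContinuousRiemannianBundle V (fun x : M => TangentSpace I x)]

lemma eventually_norm_chartTangentMap_mfderiv_le (x₀ : M) :
    ∀ᶠ x in 𝓝 x₀, ∀ v : TangentSpace I x,
      ‖chartTangentMap I x₀ (mfderiv I 𝓘(ℝ, V) (extChartAt I x₀) x v)‖ ≤ 2 * ‖v‖ := by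
  filter_upwards [eventually_norm_symmL_trivializationAt_self_comp_lt V
    (fun x : M => TangentSpace I x) x₀ one_lt_two, chart_source_mem_nhds H x₀] with x hx hxs v
  have hle := ContinuousLinearMap.le_of_opNorm_le _ hx.le v
  rwa [TangentBundle.continuousLinearMapAt_trivializationAt hxs] at hle

lemma eventually_norm_mfderivWithin_extChartAt_symm_le (x₀ : M) :
    ∀ᶠ y in 𝓝[range I] (extChartAt I x₀ x₀), ∀ v : V,
      ‖(mfderivWithin 𝓘(ℝ, V) I (extChartAt I x₀).symm (range I) y v :
        TangentSpace I ((extChartAt I x₀).symm y))‖ ≤ 2 * ‖chartTangentMap I x₀ v‖ := by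
  have hsymm : Tendsto (extChartAt I x₀).symm (𝓝[range I] (extChartAt I x₀ x₀)) (𝓝 x₀) := by
    have hcont := continuousAt_extChartAt_symm (I := I) x₀
    rw [ContinuousAt, extChartAt_to_inv] at hcont
    exact hcont.mono_left nhdsWithin_le_nhds
  filter_upwards [hsymm.eventually (eventually_norm_symmL_trivializationAt_comp_self_lt V
    (fun x : M => TangentSpace I x) x₀ one_lt_two), extChartAt_target_mem_nhdsWithin x₀]
    with y hy hyt v
  have hle := ContinuousLinearMap.le_of_opNorm_le _ hy.le (chartTangentMap I x₀ v)
  rwa [ContinuousLinearMap.comp_apply, continuousLinearMapAt_chartTangentMap,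
    symmL_extChartAt_symm hyt] at hle

end TopologicalSpace

section PseudoMetricSpace

variable [PseudoMetricSpace M] [ChartedSpace H M] [IsManifold I ∞ M]

lemma mfderivWithin_extChartAt_symm_comp_lineMap {x₀ : M} {y z : V}
    (hyz : segment ℝ y z ⊆ (extChartAt I x₀).target) {t : ℝ} (ht : t ∈ Icc (0 : ℝ) 1) :
    mfderivWithin 𝓘(ℝ, ℝ) I ((extChartAt I x₀).symm ∘ AffineMap.lineMap y z) (Icc 0 1) t (1 : ℝ) =
      mfderivWithin 𝓘(ℝ, V) I (extChartAt I x₀).symm (range I) (AffineMap.lineMap y z t)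
        (z - y) := by
  have hmaps : MapsTo (AffineMap.lineMap y z) (Icc (0 : ℝ) 1) (extChartAt I x₀).target :=
    fun s hs => hyz (segment_eq_image_lineMap ℝ y z ▸ mem_image_of_mem _ hs)
  have hline : HasMFDerivWithinAt 𝓘(ℝ, ℝ) 𝓘(ℝ, V) (AffineMap.lineMap y z) (Icc 0 1) t
      (ContinuousLinearMap.toSpanSingleton ℝ (z - y)) :=
    (AffineMap.hasDerivAt_lineMap (a := y) (b := z)).hasFDerivAt.hasMFDerivAt.hasMFDerivWithinAt
  have hcomp := (mdifferentiableWithinAt_extChartAt_symm (hmaps ht)).hasMFDerivWithinAt.comp t hline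
    (hmaps.mono_right (extChartAt_target_subset_range x₀))
  rw [hcomp.mfderivWithin (uniqueDiffOn_Icc zero_lt_one t ht).uniqueMDiffWithinAt]
  exact congrArg (mfderivWithin 𝓘(ℝ, V) I (extChartAt I x₀).symm (range I)
    (AffineMap.lineMap y z t)) (one_smul ℝ (z - y))

variable [RiemannianBundle (fun x : M => TangentSpace I x)] [IsRiemannianManifold I M]

lemma dist_extChartAt_symm_le_of_norm_mfderivWithin_le {x₀ : M} {y z : V} {c : ℝ}
    (hyz : segment ℝ y z ⊆ (extChartAt I x₀).target)
    (hc : ∀ w ∈ segment ℝ y z,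
      ‖(mfderivWithin 𝓘(ℝ, V) I (extChartAt I x₀).symm (range I) w (z - y) :
        TangentSpace I ((extChartAt I x₀).symm w))‖ ≤ c) :
    dist ((extChartAt I x₀).symm y) ((extChartAt I x₀).symm z) ≤ c := by
  let η : ℝ → V := AffineMap.lineMap (k := ℝ) y z
  have hη : MapsTo η (Icc 0 1) (segment ℝ y z) :=
    fun s hs => segment_eq_image_lineMap ℝ y z ▸ mem_image_of_mem _ hs
  have hηs : ContMDiffOn 𝓘(ℝ, ℝ) 𝓘(ℝ, V) 1 η (Icc 0 1) :=
    contMDiffOn_iff_contDiffOn.2 (ContinuousAffineMap.lineMap (R := ℝ) y z).contDiff.contDiffOn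
  have hlen : pathELength I ((extChartAt I x₀).symm ∘ η) 0 1 ≤ ENNReal.ofReal c := by
    rw [pathELength_eq_lintegral_mfderivWithin_Icc]
    calc _ ≤ ∫⁻ _ in Icc (0 : ℝ) 1, ENNReal.ofReal c := by
          refine setLIntegral_mono' measurableSet_Icc fun t ht => ?_
          rw [← ofReal_norm]
          refine ENNReal.ofReal_le_ofReal ((le_of_eq ?_).trans (hc _ (hη ht)))
          exact congrArg (fun w : TangentSpace I ((extChartAt I x₀).symm (η t)) => ‖w‖)
            (mfderivWithin_extChartAt_symm_comp_lineMap hyz ht)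
      _ = ENNReal.ofReal c := by simp
  rw [← edist_le_ofReal ((norm_nonneg _).trans (hc y (left_mem_segment ℝ y z))),
    IsRiemannianManifold.out (I := I)]
  refine (riemannianEDist_le_pathELength ?_ ?_ ?_ zero_le_one).trans hlen
  · exact (contMDiffOn_extChartAt_symm x₀).comp hηs (hη.mono_right hyz)
  · simp [η]
  · simp [η]

variable [IsContinuousRiemannianBundle V (fun x : M => TangentSpace I x)]

lemma exists_ball_dist_extChartAt_symm_le (x₀ : M) :
    ∃ r > 0, ∀ y ∈ Metric.ball (extChartAt I x₀ x₀) r ∩ range I,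
      ∀ z ∈ Metric.ball (extChartAt I x₀ x₀) r ∩ range I,
        dist ((extChartAt I x₀).symm y) ((extChartAt I x₀).symm z) ≤
          2 * ‖chartTangentMap I x₀ (y - z)‖ := by
  obtain ⟨r, hr, hsub⟩ := Metric.mem_nhdsWithin_iff.1
    (inter_mem (extChartAt_target_mem_nhdsWithin (I := I) x₀)
      (eventually_norm_mfderivWithin_extChartAt_symm_le (I := I) x₀))
  refine ⟨r, hr, fun y hy z hz => ?_⟩
  have hseg : segment ℝ y z ⊆ Metric.ball (extChartAt I x₀ x₀) r ∩ range I :=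
    ((convex_ball _ r).inter I.convex_range).segment_subset hy hz
  rw [← norm_neg (chartTangentMap I x₀ _), ← map_neg, neg_sub]
  exact dist_extChartAt_symm_le_of_norm_mfderivWithin_le (fun w hw => (hsub (hseg hw)).1)
    fun w hw => (hsub (hseg hw)).2 (z - y)

end PseudoMetricSpace

end ChartEstimates

/-! ### Smooth approximation of Lipschitz functions on Riemannian manifolds -/

section DifferentialEstimates

variable {V F H M : Type*} [NormedAddCommGroup V] [NormedSpace ℝ V] [NormedAddCommGroup F]
  [NormedSpace ℝ F] [TopologicalSpace H] {I : ModelWithCorners ℝ V H} [TopologicalSpace M]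
  [ChartedSpace H M] [IsManifold I ∞ M]

lemma inTangentCoordinates_mfderiv_comp_continuousLinearMapAt (f : M → F) {x₀ x : M}
    (hx : x ∈ (chartAt H x₀).source) :
    inTangentCoordinates I 𝓘(ℝ, F) id f (mfderiv I 𝓘(ℝ, F) f) x₀ x ∘L
      (trivializationAt V (TangentSpace I) x₀).continuousLinearMapAt ℝ x = mvfderiv I f x := by
  have hxb : x ∈ (trivializationAt V (TangentSpace I) x₀).baseSet := by
    rwa [TangentBundle.trivializationAt_baseSet]
  ext v
  simp only [inTangentCoordinates, ContinuousLinearMap.inCoordinates, id,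
    TangentBundle.continuousLinearMapAt_model_space]
  exact congrArg (mvfderiv I f x) (Trivialization.symmL_continuousLinearMapAt _ hxb v)

variable [RiemannianBundle (fun x : M => TangentSpace I x)]
  [IsContinuousRiemannianBundle V (fun x : M => TangentSpace I x)]

lemma exists_eventually_norm_mvfderiv_le {f : M → F} {x₀ : M}
    (hf : ContMDiffAt I 𝓘(ℝ, F) 1 f x₀) :
    ∃ c, ∀ᶠ x in 𝓝 x₀, ‖mvfderiv I f x‖ ≤ c := by
  let A := inTangentCoordinates I 𝓘(ℝ, F) id f (mfderiv I 𝓘(ℝ, F) f) x₀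
  have hA : ContinuousAt A x₀ := (hf.mfderiv_const (m := 0) (by simp)).continuousAt
  obtain ⟨B, -, hB⟩ := eventually_norm_trivializationAt_lt V (fun x : M => TangentSpace I x) x₀
  refine ⟨(‖A x₀‖ + 1) * B, ?_⟩
  filter_upwards [hB, hA.norm.eventually (gt_mem_nhds (lt_add_one _)),
    chart_source_mem_nhds H x₀] with x hxB hxA hx
  rw [← inTangentCoordinates_mfderiv_comp_continuousLinearMapAt f hx]
  exact (ContinuousLinearMap.opNorm_comp_le _ _).trans
    (mul_le_mul hxA.le hxB.le (norm_nonneg _) (by positivity))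

lemma exists_forall_norm_mvfderiv_le {f : M → F} (hf : ContMDiff I 𝓘(ℝ, F) 1 f) {K : Set M}
    (hK : IsCompact K) : ∃ c, ∀ x ∈ K, ‖mvfderiv I f x‖ ≤ c := by
  refine hK.induction_on (p := fun s => ∃ c, ∀ x ∈ s, ‖mvfderiv I f x‖ ≤ c) ⟨0, by simp⟩
    (fun s t hst ⟨c, hc⟩ => ⟨c, fun x hx => hc x (hst hx)⟩) ?_ fun x _ => ?_
  · rintro s t ⟨c, hc⟩ ⟨d, hd⟩
    refine ⟨max c d, fun x hx => hx.elim (fun hs => ?_) fun ht => ?_⟩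
    exacts [(hc x hs).trans (le_max_left c d), (hd x ht).trans (le_max_right c d)]
  · obtain ⟨c, hc⟩ := exists_eventually_norm_mvfderiv_le (hf x)
    exact ⟨_, mem_nhdsWithin_of_mem_nhds hc, c, fun y hy => hy⟩

end DifferentialEstimates

section LocalApproximation

variable {V H M : Type*} [NormedAddCommGroup V] [NormedSpace ℝ V] [FiniteDimensional ℝ V]
  [TopologicalSpace H] {I : ModelWithCorners ℝ V H} [PseudoMetricSpace M] [ChartedSpace H M]
  [IsManifold I ∞ M] [RiemannianBundle (fun x : M => TangentSpace I x)]
  [IsContinuousRiemannianBundle V (fun x : M => TangentSpace I x)] [IsRiemannianManifold I M]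

/- The chart distorts the metric near `x₀` by a factor arbitrarily close to `1`; here it is at most
`2` for the distance and at most `2` for the differential. -/
lemma exists_nhds_smooth_approx {g : M → ℝ} (hg : LipschitzWith 1 g) (x₀ : M) :
    ∃ U ∈ 𝓝 x₀, ∀ ε > 0, ∃ f : M → ℝ, ∀ x ∈ U,
      ContMDiffAt I 𝓘(ℝ, ℝ) ∞ f x ∧ |f x - g x| ≤ ε ∧ ‖mvfderiv I f x‖ ≤ 4 := by
  obtain ⟨r, hr, hdist⟩ := exists_ball_dist_extChartAt_symm_le (I := I) x₀
  have : FiniteDimensional ℝ (TangentSpace I x₀) := inferInstanceAs (FiniteDimensional ℝ V)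
  set φ := extChartAt I x₀
  have hball : φ ⁻¹' Metric.ball (φ x₀) r ∈ 𝓝 x₀ :=
    (continuousAt_extChartAt x₀).preimage_mem_nhds (Metric.ball_mem_nhds _ hr)
  refine ⟨_, inter_mem (inter_mem hball (chart_source_mem_nhds H x₀))
    (eventually_norm_chartTangentMap_mfderiv_le (I := I) x₀), fun ε hε => ?_⟩
  obtain ⟨F, hF, hF', hFg⟩ := exists_contDiff_norm_fderiv_apply_le (L := 2)
    (chartTangentMap I x₀) (g := g ∘ φ.symm) (s := Metric.ball (φ x₀) r ∩ range I)
    (fun y hy z hz => by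
      simpa [Real.dist_eq] using (hg.dist_le_mul (φ.symm y) (φ.symm z)).trans
        (mul_le_mul_of_nonneg_left (hdist y hy z hz) (by simp))) hε
  refine ⟨F ∘ φ, fun x hx => ?_⟩
  obtain ⟨⟨hxb, hxs⟩, hxe⟩ := hx
  have hxs' : x ∈ φ.source := by rwa [extChartAt_source]
  refine ⟨hF.contMDiff.contMDiffAt.comp x (contMDiffAt_extChartAt' hxs), ?_,
    ContinuousLinearMap.opNorm_le_bound _ (by simp) fun v => ?_⟩
  · simpa [φ.left_inv hxs'] using
      hFg (φ x) ⟨hxb, extChartAt_target_subset_range x₀ (φ.map_source hxs')⟩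
  · rw [mvfderiv_comp_apply x (hF.differentiable (by simp) _).mdifferentiableAt
      (mdifferentiableAt_extChartAt hxs)]
    calc _ ≤ 2 * ‖chartTangentMap I x₀ (mfderiv I 𝓘(ℝ, V) φ x v)‖ := by
          have hdF : mvfderiv 𝓘(ℝ, V) F (φ x) = fderiv ℝ F (φ x) := mfderiv_eq_fderiv
          exact hdF ▸ hF' _ _
      _ ≤ 2 * (2 * ‖v‖) := mul_le_mul_of_nonneg_left (hxe v) (by simp)
      _ = 4 * ‖v‖ := by ring

end LocalApproximation

section Gluing

variable {V H M ι : Type*} [NormedAddCommGroup V] [NormedSpace ℝ V] [TopologicalSpace H]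
  {I : ModelWithCorners ℝ V H}

lemma mvfderiv_finset_sum [TopologicalSpace M] [ChartedSpace H M] {f : ι → M → ℝ} {x : M}
    (s : Finset ι) (hf : ∀ i ∈ s, MDifferentiableAt I 𝓘(ℝ, ℝ) (f i) x) :
    MDifferentiableAt I 𝓘(ℝ, ℝ) (∑ i ∈ s, f i) x ∧
      mvfderiv I (∑ i ∈ s, f i) x = ∑ i ∈ s, mvfderiv I (f i) x := by
  classical
  induction s using Finset.induction_on with
  | empty => exact ⟨mdifferentiableAt_const (c := (0 : ℝ)), mvfderiv_zero⟩
  | insert i s hi ih =>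
    obtain ⟨hs, hsum⟩ := ih fun j hj => hf j (Finset.mem_insert_of_mem hj)
    have hfi := hf i (Finset.mem_insert_self i s)
    rw [Finset.sum_insert hi, Finset.sum_insert hi, mvfderiv_add hfi hs, hsum]
    exact ⟨hfi.add hs, rfl⟩

lemma norm_sum_smul_add_sum_smul_le {E : Type*} [SeminormedAddCommGroup E] [NormedSpace ℝ E]
    {s : Finset ι} {w t : ι → ℝ} {u v : ι → E} {B : ℝ} (hw₀ : ∀ j ∈ s, 0 ≤ w j)
    (hw₁ : ∑ j ∈ s, w j = 1) (hu : ∀ j ∈ s, ‖u j‖ ≤ B)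
    (ht : ∀ j ∈ s, |t j| ≤ (1 + ∑ i ∈ s, ‖v i‖)⁻¹) :
    ‖∑ j ∈ s, w j • u j + ∑ j ∈ s, t j • v j‖ ≤ B + 1 := by
  set S := ∑ i ∈ s, ‖v i‖
  have hS : 0 ≤ S := Finset.sum_nonneg fun j _ => norm_nonneg (v j)
  refine (norm_add_le _ _).trans (add_le_add ?_ ?_)
  · exact mem_closedBall_zero_iff.1 ((convex_closedBall 0 B).sum_mem hw₀ hw₁ fun j hj =>
      mem_closedBall_zero_iff.2 (hu j hj))
  · calc ‖∑ j ∈ s, t j • v j‖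
        ≤ ∑ j ∈ s, (1 + S)⁻¹ * ‖v j‖ := norm_sum_le_of_le s fun j hj => by
          rw [norm_smul]
          exact mul_le_mul_of_nonneg_right (ht j hj) (norm_nonneg (v j))
      _ = S / (1 + S) := by rw [← Finset.mul_sum, inv_mul_eq_div]
      _ ≤ 1 := div_le_one_of_le₀ (by linarith) (by linarith)

variable [TopologicalSpace M] [ChartedSpace H M]
  (ρ : SmoothPartitionOfUnity ι I M univ)

lemma finsum_smul_eventuallyEq (f : ι → M → ℝ) (x : M) (a : ℝ) :
    (fun y => ∑ᶠ j, ρ j y • f j y) =ᶠ[𝓝 x]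
      (∑ j ∈ ρ.fintsupport x, ⇑(ρ j) * (f j - fun _ => a)) + fun _ => a := by
  filter_upwards [ρ.eventually_finsupport_subset x] with y hy
  have hsum : ∑ᶠ j, ρ j y • f j y = ∑ j ∈ ρ.fintsupport x, ρ j y * f j y :=
    finsum_eq_sum_of_support_subset _ fun j hj => hy ((ρ.mem_finsupport y).2
      (left_ne_zero_of_smul hj))
  simp only [hsum, Pi.add_apply, Finset.sum_apply, Pi.mul_apply, Pi.sub_apply, mul_sub,
    Finset.sum_sub_distrib, ← Finset.sum_mul, ρ.sum_finsupport' y (mem_univ y) hy, one_mul,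
    sub_add_cancel]

/- The constant `a` may be subtracted since the differentials of a partition of unity add up to
zero. -/
lemma mvfderiv_finsum_smul {f : ι → M → ℝ} {x : M}
    (hf : ∀ j ∈ ρ.fintsupport x, MDifferentiableAt I 𝓘(ℝ, ℝ) (f j) x) (a : ℝ) :
    mvfderiv I (fun y => ∑ᶠ j, ρ j y • f j y) x =
      (∑ j ∈ ρ.fintsupport x, ρ j x • mvfderiv I (f j) x) +
        ∑ j ∈ ρ.fintsupport x, (f j x - a) • mvfderiv I (ρ j) x := by
  have hconst : MDifferentiableAt I 𝓘(ℝ, ℝ) (fun _ : M => a) x := mdifferentiableAt_const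
  have hρ : ∀ j, MDifferentiableAt I 𝓘(ℝ, ℝ) (ρ j) x := fun j =>
    (ρ j).contMDiff.mdifferentiableAt (by simp)
  obtain ⟨hdiff, hsum⟩ := mvfderiv_finset_sum (ρ.fintsupport x)
    fun j hj => (hρ j).mul ((hf j hj).sub hconst)
  calc mvfderiv I (fun y => ∑ᶠ j, ρ j y • f j y) x
      = mvfderiv I ((∑ j ∈ ρ.fintsupport x, ⇑(ρ j) * (f j - fun _ => a)) + fun _ => a) x :=
        (finsum_smul_eventuallyEq ρ f x a).mfderiv_eq
    _ = ∑ j ∈ ρ.fintsupport x, mvfderiv I (⇑(ρ j) * (f j - fun _ => a)) x := by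
        rw [mvfderiv_add hdiff hconst, mvfderiv_const, add_zero, hsum]
    _ = _ := by
        rw [← Finset.sum_add_distrib]
        refine Finset.sum_congr rfl fun j hj => ?_
        rw [mvfderiv_mul (hρ j) ((hf j hj).sub hconst), mvfderiv_sub (hf j hj) hconst,
          mvfderiv_const, sub_zero]
        rfl

variable [RiemannianBundle (fun x : M => TangentSpace I x)]

lemma norm_mvfderiv_finsum_smul_le {f : ι → M → ℝ} {x : M} {a B : ℝ}
    (hf : ∀ j ∈ ρ.fintsupport x, MDifferentiableAt I 𝓘(ℝ, ℝ) (f j) x)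
    (hB : ∀ j ∈ ρ.fintsupport x, ‖mvfderiv I (f j) x‖ ≤ B)
    (ha : ∀ j ∈ ρ.fintsupport x,
      |f j x - a| ≤ (1 + ∑ i ∈ ρ.fintsupport x, ‖mvfderiv I (ρ i) x‖)⁻¹) :
    ‖mvfderiv I (fun y => ∑ᶠ j, ρ j y • f j y) x‖ ≤ B + 1 := by
  have hsum : ∑ j ∈ ρ.fintsupport x, ρ j x = 1 :=
    ρ.sum_finsupport' x (mem_univ x) (ρ.finsupport_subset_fintsupport x)
  rw [mvfderiv_finsum_smul ρ hf a]
  exact norm_sum_smul_add_sum_smul_le (E := TangentSpace I x →L[ℝ] ℝ)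
    (fun j _ => ρ.nonneg j x) hsum hB ha

variable [IsManifold I ∞ M] [IsContinuousRiemannianBundle V (fun x : M => TangentSpace I x)]

lemma exists_forall_sum_norm_mvfderiv_le {K : Set M} (hK : IsCompact K) :
    ∃ c, ∀ x ∈ K, ∑ j ∈ ρ.fintsupport x, ‖mvfderiv I (ρ j) x‖ ≤ c := by
  have hfin := ρ.locallyFinite.closure.finite_nonempty_inter_compact hK
  choose c hc using fun j => exists_forall_norm_mvfderiv_le ((ρ j).contMDiff.of_le (by simp)) hK
  refine ⟨∑ j ∈ hfin.toFinset, c j, fun x hx => ?_⟩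
  have hsub : ρ.fintsupport x ⊆ hfin.toFinset := fun j hj =>
    hfin.mem_toFinset.2 ⟨x, (ρ.mem_fintsupport_iff x j).1 hj, hx⟩
  calc ∑ j ∈ ρ.fintsupport x, ‖mvfderiv I (ρ j) x‖
      ≤ ∑ j ∈ hfin.toFinset, ‖mvfderiv I (ρ j) x‖ :=
        Finset.sum_le_sum_of_subset_of_nonneg hsub fun j _ _ =>
          norm_nonneg (mvfderiv I (ρ j) x)
    _ ≤ ∑ j ∈ hfin.toFinset, c j := Finset.sum_le_sum fun j _ => hc j x hx

end Gluing

section GlobalApproximation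

variable {V H M : Type*} [NormedAddCommGroup V] [NormedSpace ℝ V] [FiniteDimensional ℝ V]
  [TopologicalSpace H] {I : ModelWithCorners ℝ V H} [MetricSpace M] [ChartedSpace H M]
  [IsManifold I ∞ M] [RiemannianBundle (fun x : M => TangentSpace I x)]
  [IsContinuousRiemannianBundle V (fun x : M => TangentSpace I x)] [IsRiemannianManifold I M]
  [SigmaCompactSpace M]

theorem exists_smooth_approx_of_lipschitzWith {g : M → ℝ} (hg : LipschitzWith 1 g) :
    ∃ f : C^∞⟮I, M; ℝ⟯, ∀ x, |f x - g x| ≤ 1 ∧ ‖mvfderiv I f x‖ ≤ 5 := by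
  have : LocallyCompactSpace H := I.locallyCompactSpace
  have : LocallyCompactSpace M := ChartedSpace.locallyCompactSpace H M
  choose U hU happrox using exists_nhds_smooth_approx (I := I) hg
  choose K hK hKn using fun x : M => exists_compact_mem_nhds x
  obtain ⟨ρ, hρ⟩ := SmoothPartitionOfUnity.exists_isSubordinate I isClosed_univ
    (fun x => interior (U x ∩ K x)) (fun _ => isOpen_interior) fun x _ =>
      mem_iUnion.2 ⟨x, mem_interior_iff_mem_nhds.2 (inter_mem (hU x) (hKn x))⟩
  choose c hc using fun j => exists_forall_sum_norm_mvfderiv_le ρ (hK j)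
  choose f hf using fun j => happrox j (1 + |c j|)⁻¹ (by positivity)
  have hρU : ∀ j, ∀ x ∈ tsupport (ρ j), x ∈ U j ∩ K j := fun j x hx => interior_subset (hρ j hx)
  have hsmooth : ContMDiff I 𝓘(ℝ, ℝ) ∞ fun x => ∑ᶠ j, ρ j x • f j x :=
    ρ.contMDiff_finsum_smul fun j x hx => (hf j x (hρU j x hx).1).1
  refine ⟨⟨_, hsmooth⟩, fun x => ⟨?_, ?_⟩⟩
  · refine ρ.finsum_smul_mem_convex (mem_univ x) (fun j hj => ?_) (convex_closedBall (g x) 1)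
    exact ((hf j x (hρU j x (subset_tsupport _ hj)).1).2.1).trans
      (inv_le_one_of_one_le₀ (le_add_of_nonneg_right (abs_nonneg (c j))))
  · have hxU : ∀ j ∈ ρ.fintsupport x, x ∈ U j ∩ K j := fun j hj =>
      hρU j x ((ρ.mem_fintsupport_iff x j).1 hj)
    refine (norm_mvfderiv_finsum_smul_le ρ (a := g x) (B := 4)
      (fun j hj => (hf j x (hxU j hj).1).1.mdifferentiableAt (by simp))
      (fun j hj => (hf j x (hxU j hj).1).2.2) fun j hj => ?_).trans_eq (by norm_num)
    refine (hf j x (hxU j hj).1).2.1.trans (inv_anti₀ ?_ ?_)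
    · exact add_pos_of_pos_of_nonneg one_pos
        (Finset.sum_nonneg fun i _ => norm_nonneg (mvfderiv I (ρ i) x))
    · exact add_le_add_right ((hc j x (hxU j hj).2).trans (le_abs_self (c j))) 1

end GlobalApproximation

/-! ### The Hopf–Rinow theorem -/

section LengthSpace

/-- The metric condition behind the Hopf–Rinow theorem: whenever the distances permit it, there are
points at distance at most `a` from `p` and less than `b` from `x`. Length spaces have this
property. -/
def HasIntermediatePoints {X : Type*} [PseudoMetricSpace X] (p : X) : Prop :=
  ∀ x a b, 0 ≤ a → 0 < b → dist x p < a + b → ∃ z ∈ Metric.closedBall p a, dist x z < b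

variable {X : Type*} [PseudoMetricSpace X] {p : X} {r : ℝ}

lemma HasIntermediatePoints.closedBall_subset_thickening (hp : HasIntermediatePoints p) {δ : ℝ}
    (hr : 0 ≤ r) (hδ : 0 < δ) {s : ℝ} (hs : s < r + δ) :
    Metric.closedBall p s ⊆ Metric.thickening δ (Metric.closedBall p r) := fun x hx =>
  Metric.mem_thickening_iff.2 (hp x r δ hr hδ ((Metric.mem_closedBall.1 hx).trans_lt hs))

lemma HasIntermediatePoints.totallyBounded_closedBall (hp : HasIntermediatePoints p)
    (hr : 0 < r) (h : ∀ s < r, TotallyBounded (Metric.closedBall p s)) :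
    TotallyBounded (Metric.closedBall p r) := by
  refine Metric.totallyBounded_iff.2 fun ε hε => ?_
  have hlt : max 0 (r - ε / 4) < r := max_lt hr (by linarith)
  obtain ⟨t, ht, hcover⟩ := Metric.totallyBounded_iff.1 (h _ hlt) (ε / 2) (half_pos hε)
  have hthick := hp.closedBall_subset_thickening (le_max_left 0 (r - ε / 4)) (half_pos hε)
    (show r < max 0 (r - ε / 4) + ε / 2 by linarith [le_max_right 0 (r - ε / 4)])
  refine ⟨t, ht, fun x hx => ?_⟩
  obtain ⟨z, hz, hxz⟩ := Metric.mem_thickening_iff.1 (hthick hx)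
  obtain ⟨y, hy, hzy⟩ := mem_iUnion₂.1 (hcover hz)
  exact mem_iUnion₂.2 ⟨y, hy, (dist_triangle x z y).trans_lt
    ((add_lt_add hxz (Metric.mem_ball.1 hzy)).trans_eq (add_halves ε))⟩

lemma HasIntermediatePoints.exists_gt_isCompact_closedBall [LocallyCompactSpace X]
    (hp : HasIntermediatePoints p) (hr : 0 ≤ r) (h : IsCompact (Metric.closedBall p r)) :
    ∃ s > r, IsCompact (Metric.closedBall p s) := by
  obtain ⟨δ, hδ, hcompact⟩ := h.exists_isCompact_cthickening
  refine ⟨r + δ / 2, by linarith, hcompact.of_isClosed_subset Metric.isClosed_closedBall ?_⟩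
  exact (hp.closedBall_subset_thickening hr hδ (by linarith)).trans
    (Metric.thickening_subset_cthickening _ _)

theorem HasIntermediatePoints.properSpace [LocallyCompactSpace X] [CompleteSpace X]
    (hp : HasIntermediatePoints p) : ProperSpace X := by
  refine .of_seq_closedBall (x := p) tendsto_id (.of_forall fun r => ?_)
  by_contra hr
  set S := {s | IsCompact (Metric.closedBall p s)}
  have hbdd : BddAbove S := ⟨r, fun s hs => not_lt.1 fun hrs => hr
    (hs.of_isClosed_subset Metric.isClosed_closedBall (Metric.closedBall_subset_closedBall hrs.le))⟩
  obtain ⟨r₀, hr₀, hr₀S⟩ := Metric.exists_isCompact_closedBall p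
  have hpos : 0 < sSup S := hr₀.trans_le (le_csSup hbdd hr₀S)
  have hmem : IsCompact (Metric.closedBall p (sSup S)) := by
    refine (hp.totallyBounded_closedBall hpos fun s hs => ?_).isCompact_of_isClosed
      Metric.isClosed_closedBall
    obtain ⟨t, ht, hst⟩ := exists_lt_of_lt_csSup ⟨r₀, hr₀S⟩ hs
    exact ht.totallyBounded.subset (Metric.closedBall_subset_closedBall hst.le)
  obtain ⟨s, hs, hsS⟩ := hp.exists_gt_isCompact_closedBall hpos.le hmem
  exact hs.not_ge (le_csSup hbdd hsS)

end LengthSpace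

section Riemannian

variable {V H M : Type*} [NormedAddCommGroup V] [NormedSpace ℝ V] [TopologicalSpace H]
  (I : ModelWithCorners ℝ V H) [PseudoMetricSpace M] [ChartedSpace H M]
  [RiemannianBundle (fun x : M => TangentSpace I x)] [IsRiemannianManifold I M]

include I

lemma hasIntermediatePoints_of_isRiemannianManifold (p : M) : HasIntermediatePoints p := by
  intro x a b ha hb h
  rcases le_or_gt (dist x p) a with hle | hgt
  · exact ⟨x, hle, by simpa using hb⟩
  have hlt : riemannianEDist I p x < ENNReal.ofReal (a + b) := by
    rwa [← IsRiemannianManifold.out (I := I), edist_comm, edist_lt_ofReal]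
  obtain ⟨γ, hγ0, hγ1, hγ, hlen⟩ := exists_lt_of_riemannianEDist_lt hlt
  have hcont : ContinuousOn (fun t => dist (γ t) p) (Icc 0 1) :=
    (continuous_id.dist continuous_const).comp_continuousOn hγ.continuousOn
  obtain ⟨t, ht, hta⟩ := intermediate_value_Icc zero_le_one hcont
    ⟨by simpa only [hγ0, dist_self] using ha, by simpa only [hγ1] using hgt.le⟩
  have hleft : edist p (γ t) ≤ pathELength I γ 0 t := by
    rw [IsRiemannianManifold.out (I := I)]
    exact riemannianEDist_le_pathELength (hγ.mono (Icc_subset_Icc_right ht.2)) hγ0 rfl ht.1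
  have hright : edist (γ t) x ≤ pathELength I γ t 1 := by
    rw [IsRiemannianManifold.out (I := I)]
    exact riemannianEDist_le_pathELength (hγ.mono (Icc_subset_Icc_left ht.1)) rfl hγ1 ht.2
  have hsum : ENNReal.ofReal (a + dist x (γ t)) < ENNReal.ofReal (a + b) := by
    calc ENNReal.ofReal (a + dist x (γ t)) = edist p (γ t) + edist (γ t) x := by
          rw [ENNReal.ofReal_add ha dist_nonneg, ← hta, edist_comm, edist_comm (γ t) x,
            edist_dist, edist_dist]
      _ ≤ pathELength I γ 0 t + pathELength I γ t 1 := add_le_add hleft hright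
      _ < ENNReal.ofReal (a + b) := by rwa [pathELength_add ht.1 ht.2]
  exact ⟨γ t, hta.le, by linarith [(ENNReal.ofReal_lt_ofReal_iff (by linarith)).1 hsum]⟩

theorem properSpace_of_isRiemannianManifold [FiniteDimensional ℝ V] [CompleteSpace M] :
    ProperSpace M := by
  have : LocallyCompactSpace H := I.locallyCompactSpace
  have : LocallyCompactSpace M := ChartedSpace.locallyCompactSpace H M
  cases isEmpty_or_nonempty M
  · infer_instance
  · exact (hasIntermediatePoints_of_isRiemannianManifold I (Classical.arbitrary M)).properSpace

end Riemannian

/-! ### Primitives of functions with divergent integral -/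

section DivergentIntegral

lemma tendsto_intervalIntegral_atTop_of_lintegral_eq_top {a : ℝ → ℝ} (ha : Continuous a)
    (ha₀ : ∀ r, 0 ≤ a r) (hint : ∫⁻ r in Ioi (0 : ℝ), ENNReal.ofReal (a r) = ⊤) :
    Tendsto (fun r => ∫ t in (0 : ℝ)..r, a t) atTop atTop := by
  have hmono : Monotone fun r => ∫ t in (0 : ℝ)..r, a t := fun r s hrs => by
    rw [← sub_nonneg, intervalIntegral.integral_interval_sub_left (ha.intervalIntegrable _ _)
      (ha.intervalIntegrable _ _)]
    exact intervalIntegral.integral_nonneg hrs fun t _ => ha₀ t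
  refine tendsto_atTop_atTop_of_monotone hmono fun b => ?_
  by_contra! hb
  have hai : IntegrableOn a (Ioi 0) :=
    integrableOn_Ioi_of_intervalIntegral_norm_bounded b 0 (l := atTop) (b := id)
      (fun r => ha.integrableOn_Ioc) tendsto_id
      (.of_forall fun r => by simpa only [id, Real.norm_of_nonneg (ha₀ _)] using (hb r).le)
  exact ((hasFiniteIntegral_iff_ofReal (.of_forall ha₀)).1 hai.2).ne hint

variable {β : ℝ → ℝ} (hβ : Antitone β)

include hβ

lemma setLIntegral_Ioi_comp_add_one_eq_top
    (hint : ∫⁻ r in Ioi (0 : ℝ), ENNReal.ofReal (β r) = ⊤) :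
    ∫⁻ r in Ioi (0 : ℝ), ENNReal.ofReal (β (r + 1)) = ⊤ := by
  have hshift : ∫⁻ r in Ioi (0 : ℝ), ENNReal.ofReal (β (r + 1)) =
      ∫⁻ r in Ioi (1 : ℝ), ENNReal.ofReal (β r) := by
    rw [← (measurePreserving_add_right volume (1 : ℝ)).setLIntegral_comp_preimage_emb
      (measurableEmbedding_addRight 1) _ (Ioi 1), preimage_add_const_Ioi, sub_self]
  have hfirst : ∫⁻ r in Ioc (0 : ℝ) 1, ENNReal.ofReal (β r) ≠ ⊤ := by
    refine ((setLIntegral_mono measurable_const fun r hr =>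
      ENNReal.ofReal_le_ofReal (hβ hr.1.le)).trans_lt ?_).ne
    simp
  rw [← Ioc_union_Ioi_eq_Ioi zero_le_one,
    lintegral_union measurableSet_Ioi Ioc_disjoint_Ioi_same] at hint
  exact hshift.trans ((ENNReal.add_eq_top.1 hint).resolve_left hfirst)

lemma exists_contDiff_mem_Icc_of_antitone :
    ∃ a : ℝ → ℝ, ContDiff ℝ ∞ a ∧ ∀ r, a r ∈ Icc (β (r + 1)) (β r) := by
  obtain ⟨a, ha⟩ := exists_contMDiffMap_forall_mem_convex_of_local_const (n := (⊤ : ℕ∞))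
    𝓘(ℝ, ℝ) (t := fun r => Icc (β (r + 1)) (β r)) (fun r => convex_Icc _ _) fun r => by
      refine ⟨β (r + 1 / 2), ?_⟩
      filter_upwards [Ioo_mem_nhds (show r - 1 / 2 < r by linarith)
        (show r < r + 1 / 2 by linarith)] with s hs
      exact ⟨hβ (by linarith [hs.1]), hβ hs.2.le⟩
  exact ⟨a, a.contMDiff.contDiff, ha⟩

theorem exists_contDiff_tendsto_atTop_abs_deriv_le (hβ₀ : ∀ r, 0 ≤ β r)
    (hint : ∫⁻ r in Ioi (0 : ℝ), ENNReal.ofReal (β r) = ⊤) :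
    ∃ h : ℝ → ℝ, ContDiff ℝ ∞ h ∧ Tendsto h atTop atTop ∧ ∀ r, |deriv h r| ≤ β r := by
  obtain ⟨a, ha, hmem⟩ := exists_contDiff_mem_Icc_of_antitone hβ
  have ha₀ : ∀ r, 0 ≤ a r := fun r => (hβ₀ (r + 1)).trans (hmem r).1
  have hderiv : ∀ r, HasDerivAt (fun r => ∫ t in (0 : ℝ)..r, a t) (a r) r := fun r =>
    (ha.continuous.integral_hasStrictDerivAt 0 r).hasDerivAt
  refine ⟨fun r => ∫ t in (0 : ℝ)..r, a t, ?_,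
    tendsto_intervalIntegral_atTop_of_lintegral_eq_top ha.continuous ha₀ ?_, fun r => ?_⟩
  · rw [contDiff_infty_iff_deriv, funext fun r => (hderiv r).deriv]
    exact ⟨fun r => (hderiv r).differentiableAt, ha⟩
  · rw [eq_top_iff, ← setLIntegral_Ioi_comp_add_one_eq_top hβ hint]
    exact lintegral_mono fun r => ENNReal.ofReal_le_ofReal (hmem r).1
  · rw [(hderiv r).deriv, abs_of_nonneg (ha₀ r)]
    exact (hmem r).2

end DivergentIntegral

section Exhaustion

variable {V H M : Type*} [NormedAddCommGroup V] [NormedSpace ℝ V] [FiniteDimensional ℝ V]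
  [TopologicalSpace H] {I : ModelWithCorners ℝ V H} [MetricSpace M] [ChartedSpace H M]
  [IsManifold I ∞ M] [RiemannianBundle (fun x : M => TangentSpace I x)]
  [IsContinuousRiemannianBundle V (fun x : M => TangentSpace I x)] [IsRiemannianManifold I M]
  [CompleteSpace M]

theorem exists_exhaustion_norm_mvfderiv_le (p : M) {β : ℝ → ℝ} (hβ : Antitone β)
    (hβ₀ : ∀ r, 0 ≤ β r) (hint : ∫⁻ r in Ioi (0 : ℝ), ENNReal.ofReal (β r) = ⊤) :
    ∃ ρ : C^∞⟮I, M; ℝ⟯, Tendsto ρ (cocompact M) atTop ∧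
      ∀ x, ‖mvfderiv I ρ x‖ ≤ 5 * β (dist x p) := by
  have : ProperSpace M := properSpace_of_isRiemannianManifold I
  obtain ⟨f, hf⟩ := exists_smooth_approx_of_lipschitzWith (I := I) (LipschitzWith.dist_left p)
  obtain ⟨h, hh, htop, hderiv⟩ := exists_contDiff_tendsto_atTop_abs_deriv_le hβ hβ₀ hint
  have hle : ∀ x, dist x p ≤ f x + 1 := fun x => by linarith [(abs_le.1 (hf x).1).1]
  have hg : ContDiff ℝ ∞ fun r => h (r + 1) := hh.comp (contDiff_id.add contDiff_const)
  refine ⟨⟨(fun r => h (r + 1)) ∘ f, hg.contMDiff.comp f.contMDiff⟩, ?_, fun x => ?_⟩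
  · exact htop.comp (tendsto_atTop_mono hle (tendsto_dist_right_cocompact_atTop p))
  · calc ‖mvfderiv I ((fun r => h (r + 1)) ∘ f) x‖
        ≤ |deriv h (f x + 1)| * ‖mvfderiv I f x‖ := by
          rw [mvfderiv_real_comp (hg.differentiable (by simp) _)
            (f.contMDiff.mdifferentiableAt (by simp)), deriv_comp_add_const]
          exact ContinuousLinearMap.opNorm_smul_le _ (mvfderiv I f x)
      _ ≤ β (dist x p) * 5 := by
          gcongr
          · exact hβ₀ _
          · exact (hderiv _).trans (hβ (hle x))
          · exact (hf x).2
      _ = 5 * β (dist x p) := mul_comm _ _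

end Exhaustion

section RiemannianBundle

variable {EB HB B F : Type*} [NormedAddCommGroup EB] [NormedSpace ℝ EB] [TopologicalSpace HB]
  {IB : ModelWithCorners ℝ EB HB} [TopologicalSpace B] [ChartedSpace HB B]
  [NormedAddCommGroup F] [NormedSpace ℝ F] {E : B → Type*} [TopologicalSpace (TotalSpace F E)]
  [∀ x, NormedAddCommGroup (E x)] [∀ x, InnerProductSpace ℝ (E x)] [FiberBundle F E]
  [VectorBundle ℝ F E]

lemma isContinuousRiemannianBundle_of_contMDiff {k : ℕ∞ω}
    (h : IsContMDiffRiemannianBundle IB k F E) : IsContinuousRiemannianBundle F E :=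
  let ⟨g, hg, hinner⟩ := h.exists_contMDiff
  ⟨g, hg.continuous, hinner⟩

end RiemannianBundle

end FirstOrderCompleteness

end

open FirstOrderCompleteness in
theorem theorem2p1_general
    {n : ℕ} {H : Type*} [TopologicalSpace H]
    (I : ModelWithCorners ℝ (EuclideanSpace ℝ (Fin n)) H)
    {M : Type*} [MetricSpace M] [ChartedSpace H M] [IsManifold I ∞ M]
    [SecondCountableTopology M]
    [RiemannianBundle (fun x : M => TangentSpace I x)]
    [IsContinuousRiemannianBundle (EuclideanSpace ℝ (Fin n)) (fun x : M => TangentSpace I x)]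
    [IsRiemannianManifold I M] [CompleteSpace M]
    [MeasurableSpace M] [BorelSpace M] (μ : Measure M) (hμ : IsSmoothMeasure I μ)
    {E₀ : Type*} [NormedAddCommGroup E₀] [NormedSpace ℂ E₀] [FiniteDimensional ℂ E₀]
    {E : M → Type*} [TopologicalSpace (TotalSpace E₀ E)]
    [∀ x, NormedAddCommGroup (E x)] [∀ x, InnerProductSpace ℂ (E x)]
    [FiberBundle E₀ E] [VectorBundle ℂ E₀ E] [VectorBundle ℝ E₀ E]
    [ContMDiffVectorBundle ∞ E₀ E I] (hE : IsSmoothHermitian I E₀ E)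
    {F₀ : Type*} [NormedAddCommGroup F₀] [NormedSpace ℂ F₀] [FiniteDimensional ℂ F₀]
    {F : M → Type*} [TopologicalSpace (TotalSpace F₀ F)]
    [∀ x, NormedAddCommGroup (F x)] [∀ x, InnerProductSpace ℂ (F x)]
    [FiberBundle F₀ F] [VectorBundle ℂ F₀ F] [VectorBundle ℝ F₀ F]
    [ContMDiffVectorBundle ∞ F₀ F I] (hF : IsSmoothHermitian I F₀ F)
    (D : SmoothSections I E₀ E →ₗ[ℂ] SmoothSections I F₀ F) (hD : IsFirstOrder D)
    (Ddag : SmoothSections I F₀ F →ₗ[ℂ] SmoothSections I E₀ E) (hDdag : IsFormalAdjoint μ D Ddag)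
    (p : M) (C : ℝ → ℝ) (hC_mono : MonotoneOn C (Set.Ici 0)) (hC_pos : ∀ r, 0 ≤ r → 0 < C r)
    (hC_int : ∫⁻ r in Set.Ioi (0 : ℝ), ENNReal.ofReal (1 / C r) = ⊤)
    (hsymb : ∀ (x : M) (ξ : TangentSpace I x →L[ℝ] ℝ) (e : E x),
      ‖principalSymbol D x ξ e‖ ≤ C (dist x p) * ‖ξ‖ * ‖e‖) :
    IsComplete μ (maxGraph μ Ddag) ∧ IsComplete μ (maxGraph μ D) := by
  have hβ : Antitone fun r => 1 / C (max r 0) := fun r s hrs =>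
    one_div_le_one_div_of_le (hC_pos _ (le_max_right r 0))
      (hC_mono (le_max_right r 0) (le_max_right s 0) (max_le_max_right 0 hrs))
  have hβ_int : ∫⁻ r in Ioi (0 : ℝ), ENNReal.ofReal (1 / C (max r 0)) = ⊤ :=
    (setLIntegral_congr_fun measurableSet_Ioi fun r (hr : 0 < r) => by
      simp only [max_eq_left hr.le]).trans hC_int
  obtain ⟨ρ, hρ, hbound⟩ := exists_exhaustion_norm_mvfderiv_le (I := I) p hβ
    (fun r => (one_div_pos.2 (hC_pos _ (le_max_right r 0))).le) hβ_int
  refine isComplete_of_exhaustion hμ hE hF hD hDdag hρ (c := 5) (by norm_num) fun x e => ?_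
  have hpos := hC_pos _ (dist_nonneg (x := x) (y := p))
  have hdρ : ‖mvfderiv I ρ x‖ ≤ 5 * (1 / C (dist x p)) := by
    simpa only [max_eq_left dist_nonneg] using hbound x
  calc ‖symbolMap hD ρ x e‖ ≤ C (dist x p) * ‖mvfderiv I ρ x‖ * ‖e‖ := hsymb x _ e
    _ ≤ C (dist x p) * (5 * (1 / C (dist x p))) * ‖e‖ := by gcongr
    _ = 5 * ‖e‖ := by field_simp

open FirstOrderCompleteness in
theorem theorem2p1
    -- a connected smooth manifold (possibly with boundary)
    {n : ℕ} {H : Type*} [TopologicalSpace H]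
    (I : ModelWithCorners ℝ (EuclideanSpace ℝ (Fin n)) H)
    {M : Type*} [MetricSpace M] [ChartedSpace H M] [IsManifold I ∞ M]
    [SecondCountableTopology M]
    -- a complete Riemannian metric, whose distance function is `dist`
    [RiemannianBundle (fun x : M => TangentSpace I x)]
    [IsContMDiffRiemannianBundle I ∞ (EuclideanSpace ℝ (Fin n)) (fun x : M => TangentSpace I x)]
    [IsRiemannianManifold I M] [CompleteSpace M]
    -- a smooth measure
    [MeasurableSpace M] [BorelSpace M] (μ : Measure M) (hμ : IsSmoothMeasure I μ)
    -- the Hermitian vector bundles `E` and `F`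
    {E₀ : Type*} [NormedAddCommGroup E₀] [NormedSpace ℂ E₀] [FiniteDimensional ℂ E₀]
    {E : M → Type*} [TopologicalSpace (TotalSpace E₀ E)]
    [∀ x, NormedAddCommGroup (E x)] [∀ x, InnerProductSpace ℂ (E x)]
    [FiberBundle E₀ E] [VectorBundle ℂ E₀ E] [VectorBundle ℝ E₀ E]
    [ContMDiffVectorBundle ∞ E₀ E I] (hE : IsSmoothHermitian I E₀ E)
    {F₀ : Type*} [NormedAddCommGroup F₀] [NormedSpace ℂ F₀] [FiniteDimensional ℂ F₀]
    {F : M → Type*} [TopologicalSpace (TotalSpace F₀ F)]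
    [∀ x, NormedAddCommGroup (F x)] [∀ x, InnerProductSpace ℂ (F x)]
    [FiberBundle F₀ F] [VectorBundle ℂ F₀ F] [VectorBundle ℝ F₀ F]
    [ContMDiffVectorBundle ∞ F₀ F I] (hF : IsSmoothHermitian I F₀ F)
    -- the first-order differential operator `D` and its formal adjoint `D†`
    (D : SmoothSections I E₀ E →ₗ[ℂ] SmoothSections I F₀ F) (hD : IsFirstOrder D)
    (Ddag : SmoothSections I F₀ F →ₗ[ℂ] SmoothSections I E₀ E) (hDdag : IsFormalAdjoint μ D Ddag)
    -- the bound on the principal symbol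
    (p : M) (C : ℝ → ℝ) (hC_cont : ContinuousOn C (Set.Ici 0)) (hC_mono : MonotoneOn C (Set.Ici 0))
    (hC_pos : ∀ r, 0 ≤ r → 0 < C r)
    (hC_int : ∫⁻ r in Set.Ioi (0 : ℝ), ENNReal.ofReal (1 / C r) = ⊤)
    (hsymb : ∀ (x : M) (ξ : TangentSpace I x →L[ℝ] ℝ) (e : E x),
      ‖principalSymbol D x ξ e‖ ≤ C (dist x p) * ‖ξ‖ * ‖e‖) :
    -- `D_max = (D†)*` and `(D†)_max = D*` are complete
    IsComplete μ (maxGraph μ Ddag) ∧ IsComplete μ (maxGraph μ D) := by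
  have : IsContinuousRiemannianBundle (EuclideanSpace ℝ (Fin n)) (fun x : M => TangentSpace I x) :=
    isContinuousRiemannianBundle_of_contMDiff (IB := I) (k := ∞) inferInstance
  exact theorem2p1_general I μ hμ hE hF D hD Ddag hDdag p C hC_mono hC_pos hC_int hsymb
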